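/- A complex quartic surface in $\mathbb{P}^3$, i.e. a nonzero form $F\in\mathbb{C}[x_1,x_2,x_3,x_4]_4$ up to scaling, is a point of the projective space $\mathbb{P}^{34}$ whose homogeneous coordinates are the $35$ coefficients of $F$. Let $\mathcal{QS}\subset\mathbb{P}^{34}$ be the variety of quartic symmetroids, that is, the Zariski closure of the set of all quartic surfaces with a defining form $$F(x_1,x_2,x_3,x_4)=\det\bigl(A_1x_1+A_2x_2+A_3x_3+A_4x_4\bigr)\neq 0,$$ where $A_1,A_2,A_3,A_4$ are complex symmetric $4\times 4$ matrices. **Lemma.** The variety $\mathcal{QS}$ is irreducible, it has dimension $24$, and it has codimension $10$ in $\mathbb{P}^{34}$. -/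

import Mathlib

/-- Projective space over the field `k` with homogeneous coordinates indexed by `ι`, that is, the
set of lines through the origin in `ι → k`. It carries the Zariski topology (see below). -/
def ProjSpace (k : Type*) [Field k] (ι : Type*) : Type _ :=
  Projectivization k (ι → k)

namespace ProjSpace

variable {k : Type*} [Field k] {ι : Type*}

/-- The point of projective space with homogeneous coordinates `v`. -/
def mk (v : ι → k) (hv : v ≠ 0) : ProjSpace k ι :=
  Projectivization.mk k v hv

/-- A choice of homogeneous coordinates of a point. -/
noncomputable def rep (p : ProjSpace k ι) : ι → k :=
  Projectivization.rep p

/-- The common zeros in projective space of a set `S` of polynomials. It is only used for sets of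
homogeneous polynomials, where the choice of homogeneous coordinates does not matter
(`mk_mem_zeroLocus`). -/
def zeroLocus (S : Set (MvPolynomial ι k)) : Set (ProjSpace k ι) :=
  {p | ∀ f ∈ S, MvPolynomial.eval p.rep f = 0}

theorem mk_mem_zeroLocus {S : Set (MvPolynomial ι k)} (hS : ∀ f ∈ S, ∃ n, f.IsHomogeneous n)
    (v : ι → k) (hv : v ≠ 0) :
    mk v hv ∈ zeroLocus S ↔ ∀ f ∈ S, MvPolynomial.eval v f = 0 := by
  obtain ⟨a, ha⟩ := Projectivization.exists_smul_eq_mk_rep k v hv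
  have key : ∀ f ∈ S, MvPolynomial.eval (mk v hv).rep f = 0 ↔ MvPolynomial.eval v f = 0 := by
    intro f hf
    obtain ⟨n, hn⟩ := hS f hf
    have h1 : (mk v hv).rep = (a : k) • v := ha.symm
    have h3 : MvPolynomial.eval ((a : k) • v) f = (a : k) ^ n * MvPolynomial.eval v f := by
      rw [MvPolynomial.eval_eq, MvPolynomial.eval_eq, Finset.mul_sum]
      refine Finset.sum_congr rfl fun d hd => ?_
      have hdeg : ∑ i ∈ d.support, d i = n := by
        have := hn (MvPolynomial.mem_support_iff.mp hd)
        rw [← this, ← Finsupp.degree_apply, Finsupp.degree_eq_weight_one (R := ℕ)]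
        rfl
      simp only [Pi.smul_apply, smul_eq_mul, mul_pow, Finset.prod_mul_distrib,
        Finset.prod_pow_eq_pow_sum, hdeg]
      ring
    rw [h1, h3]
    simp
  exact forall₂_congr key

/-- The Zariski topology: the closed sets are the zero loci of sets of homogeneous polynomials. -/
instance : TopologicalSpace (ProjSpace k ι) :=
  TopologicalSpace.ofClosed
    {Z | ∃ S : Set (MvPolynomial ι k), (∀ f ∈ S, ∃ n, f.IsHomogeneous n) ∧ Z = zeroLocus S}
    ⟨{1}, fun f hf => ⟨0, by rw [hf]; exact MvPolynomial.isHomogeneous_one _ _⟩, by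
      ext p; simp [zeroLocus]⟩
    (by
      intro A hA
      choose S hS hZ using fun Z : A => hA Z.2
      refine ⟨⋃ Z : A, S Z, ?_, ?_⟩
      · intro f hf
        obtain ⟨Z, hf⟩ := Set.mem_iUnion.mp hf
        exact hS Z f hf
      · ext p
        constructor
        · intro hp f hf
          obtain ⟨Z, hf⟩ := Set.mem_iUnion.mp hf
          have := hp Z.1 Z.2
          rw [hZ Z] at this
          exact this f hf
        · intro hp Z hZA
          rw [show Z = zeroLocus (S ⟨Z, hZA⟩) from hZ ⟨Z, hZA⟩]
          exact fun f hf => hp f (Set.mem_iUnion.mpr ⟨_, hf⟩))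
    (by
      rintro _ ⟨S, hS, rfl⟩ _ ⟨T, hT, rfl⟩
      refine ⟨{h | ∃ f ∈ S, ∃ g ∈ T, h = f * g}, ?_, ?_⟩
      · rintro _ ⟨f, hf, g, hg, rfl⟩
        obtain ⟨m, hm⟩ := hS f hf
        obtain ⟨n, hn⟩ := hT g hg
        exact ⟨m + n, hm.mul hn⟩
      · ext p
        constructor
        · rintro (hp | hp) _ ⟨f, hf, g, hg, rfl⟩
          · simp [hp f hf]
          · simp [hp g hg]
        · intro hp
          by_contra hcon
          simp only [Set.mem_union, not_or, zeroLocus, Set.mem_ofPred_eq, not_forall] at hcon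
          obtain ⟨⟨f, hf, hf0⟩, ⟨g, hg, hg0⟩⟩ := hcon
          have := hp (f * g) ⟨f, hf, g, hg, rfl⟩
          rw [map_mul] at this
          exact (mul_ne_zero hf0 hg0) this)

theorem isClosed_iff (Z : Set (ProjSpace k ι)) :
    IsClosed Z ↔ ∃ S : Set (MvPolynomial ι k), (∀ f ∈ S, ∃ n, f.IsHomogeneous n) ∧
      Z = zeroLocus S := by
  rw [← isOpen_compl_iff]
  change Zᶜᶜ ∈ {Z | ∃ S : Set (MvPolynomial ι k), (∀ f ∈ S, ∃ n, f.IsHomogeneous n) ∧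
      Z = zeroLocus S} ↔ _
  rw [compl_compl]
  rfl

end ProjSpace

/-- The exponents of the monomials of degree four in `x₀, x₁, x₂, x₃`. -/
abbrev QuarticMonomial : Type :=
  {d : Fin 4 →₀ ℕ // d ∈ (Finset.univ : Finset (Fin 4)).finsuppAntidiag 4}

theorem card_quarticMonomial : Fintype.card QuarticMonomial = 35 := by
  simp only [Fintype.card_coe, Finset.card_finsuppAntidiag_nat_eq_choose]
  decide

/-- The quartic form in four variables with the given coefficients. -/
noncomputable def quarticForm (c : QuarticMonomial → ℂ) : MvPolynomial (Fin 4) ℂ :=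
  ∑ d : QuarticMonomial, MvPolynomial.monomial d.1 (c d)

/-- The space `ℙ³⁴` of quartic surfaces in `ℙ³`: the homogeneous coordinates of a surface are
the `35` coefficients of a quartic form that defines it. -/
abbrev QuarticSurfaces : Type :=
  ProjSpace ℂ QuarticMonomial

/-- The polynomial `det (A₀ x₀ + A₁ x₁ + A₂ x₂ + A₃ x₃)`. -/
noncomputable def determinantalForm (A : Fin 4 → Matrix (Fin 4) (Fin 4) ℂ) :
    MvPolynomial (Fin 4) ℂ :=
  (∑ i, (MvPolynomial.X i : MvPolynomial (Fin 4) ℂ) • (A i).map MvPolynomial.C).det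

/-- The quartic surfaces that have a (nonzero) defining form
`det (A₀ x₀ + A₁ x₁ + A₂ x₂ + A₃ x₃)` with complex symmetric `4 × 4` matrices `Aᵢ`: the image of
the rational map `ℙ³⁹ ⇢ ℙ³⁴` given by the determinant. -/
def symmetroidLocus : Set QuarticSurfaces :=
  {p | ∃ (A : Fin 4 → Matrix (Fin 4) (Fin 4) ℂ) (c : QuarticMonomial → ℂ) (hc : c ≠ 0),
    (∀ i, (A i).IsSymm) ∧ quarticForm c = determinantalForm A ∧ p = ProjSpace.mk c hc}

/-- The variety of quartic symmetroids: the Zariski closure in `ℙ³⁴` of the set of quartic surfaces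
with a symmetric determinantal representation. -/
def quarticSymmetroids : Set QuarticSurfaces :=
  closure symmetroidLocus

/-!
# The variety of quartic symmetroids

The proof rests on a parametrisation with `24` parameters. A generic pencil of symmetric matrices is
congruent to one that consists of the identity, a diagonal matrix and two symmetric matrices, and a
congruence multiplies the determinant by a constant. That a generic pencil has this normal form is
expressed as an algebraic independence (`algebraicIndependent_genericCongruenceEntry`): a form that
vanishes on the symmetroids in normal form vanishes on all symmetroids
(`eval_pencilCoeff_eq_zero`). So the variety of quartic symmetroids is the closure of the image of a
polynomial map from the affine space of dimension `24`
(`quarticSymmetroids_eq_closure_paramLocus`), and hence irreducible.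

The differential of the induced parametrisation of the affine cone, which has a scaling factor as
an additional parameter, is injective at an explicit point
(`coneDifferential_normalFormCoeff_injective`). Adding ten vectors that span a complement of its
image gives a parametrisation of an open part of `ℙ³⁴` with `34` parameters. Freezing its parameters
one at a time at their values at that point gives a chain of irreducible closed subsets, one of
which is the variety of quartic symmetroids. The inclusions are strict
(`ProjSpace.paramVariety_freeze_strictMono`): by the Jacobian criterion
(`MvPolynomial.algebraicIndependent_of_jacobian`) the cone over the variety with `n` free parameters
carries `n + 1` algebraically independent functions, and it cannot carry more. So there is a chain
of length `34` in which the variety of quartic symmetroids has `24` members below it and `10` above it.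

No chain of irreducible closed subsets of `ℙ³⁴` is longer than `34`, since the vanishing ideals of
its members, together with the ideal of the origin, form a chain of prime ideals in a polynomial
ring in `35` variables (`ProjSpace.krullDim_irreducibleCloseds_add_one_le`). Therefore the chain
determines both the dimension and the codimension
(`ProjSpace.height_and_coheight_paramVariety`).
-/

/-! ### The Jacobian criterion for algebraic independence -/

namespace MvPolynomial

section Jacobian

variable {k κ ι : Type*} [Field k]

theorem eval_aeval (b : κ → k) (h : ι → MvPolynomial κ k) (f : MvPolynomial ι k) :
    eval b (aeval h f) = eval (fun i => eval b (h i)) f := by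
  induction f using MvPolynomial.induction_on with
  | C a => simp
  | add p q hp hq => simp only [map_add, hp, hq]
  | mul_X p j hp => simp only [map_mul, hp, aeval_X, eval_X]

/-- The derivative along the constant vector field `v`. -/
noncomputable def dirDeriv (v : κ → k) :
    Derivation k (MvPolynomial κ k) (MvPolynomial κ k) :=
  mkDerivation k fun j => C (v j)

@[simp]
theorem dirDeriv_X (v : κ → k) (j : κ) : dirDeriv v (X j) = C (v j) :=
  mkDerivation_X _ _ _

theorem dirDeriv_mul (v : κ → k) (f g : MvPolynomial κ k) :
    dirDeriv v (f * g) = f * dirDeriv v g + g * dirDeriv v f := by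
  simp [Derivation.leibniz]

theorem dirDeriv_add_vector (v w : κ → k) (f : MvPolynomial κ k) :
    dirDeriv (v + w) f = dirDeriv v f + dirDeriv w f := by
  have : dirDeriv (v + w) = dirDeriv v + dirDeriv w := derivation_ext fun i => by simp
  rw [this, Derivation.add_apply]

theorem dirDeriv_smul_vector (c : k) (v : κ → k) (f : MvPolynomial κ k) :
    dirDeriv (c • v) f = c • dirDeriv v f := by
  have : dirDeriv (c • v) = c • dirDeriv v :=
    derivation_ext fun i => by simp [smul_eq_C_mul]
  rw [this, Derivation.smul_apply]

/-- The chain rule. -/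
theorem eval_dirDeriv_aeval (f : ι → MvPolynomial κ k) (a v : κ → k) (p : MvPolynomial ι k) :
    eval a (dirDeriv v (aeval f p)) =
      eval (fun i => eval a (f i)) (dirDeriv (fun i => eval a (dirDeriv v (f i))) p) := by
  induction p using MvPolynomial.induction_on with
  | C a => simp [algebraMap_eq]
  | add p q hp hq => simp only [map_add, hp, hq]
  | mul_X p j hp =>
    simp only [map_mul, aeval_X, dirDeriv_mul, map_add, hp, eval_aeval, dirDeriv_X, eval_C, eval_X]

theorem derivation_aeval [Fintype ι] (D : Derivation k (MvPolynomial κ k) (MvPolynomial κ k))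
    (f : ι → MvPolynomial κ k) (g : MvPolynomial ι k) :
    D (aeval f g) = ∑ i, aeval f (pderiv i g) * D (f i) := by
  classical
  induction g using MvPolynomial.induction_on with
  | C a => simp [algebraMap_eq]
  | add p q hp hq => simp only [map_add, hp, hq, add_mul, Finset.sum_add_distrib]
  | mul_X p j hp =>
    simp only [map_mul, aeval_X, Derivation.leibniz, smul_eq_mul, hp, map_add, pderiv_X,
      add_mul, Finset.sum_add_distrib, Finset.mul_sum]
    congr 1
    · rw [Finset.sum_eq_single j]
      · simp
      · intro i _ hij
        simp [hij]
      · simp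
    · exact Finset.sum_congr rfl fun i _ => by ring

theorem eq_zero_of_pderiv_eq_zero_of_aeval_eq_zero [CharZero k] {f : ι → MvPolynomial κ k}
    {g : MvPolynomial ι k} (hg : ∀ i, pderiv i g = 0) (h : aeval f g = 0) : g = 0 := by
  have hcoeff : ∀ d, d ≠ 0 → coeff d g = 0 := by
    intro d hd
    obtain ⟨i, hi⟩ := Finsupp.ne_iff.mp hd
    have hi' : d i ≠ 0 := by simpa using hi
    have h1 := coeff_pderiv g (d - Finsupp.single i 1) (i := i)
    rw [hg i, coeff_zero, tsub_add_cancel_of_le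
      (by simpa [Finsupp.single_le_iff] using Nat.one_le_iff_ne_zero.mpr hi')] at h1
    have h2 : ((d - Finsupp.single i 1 : ι →₀ ℕ) i : k) + 1 ≠ 0 := Nat.cast_add_one_ne_zero _
    rcases mul_eq_zero.mp h1.symm with h3 | h3
    · exact h3
    · exact absurd h3 h2
  have hC : g = C (coeff 0 g) := by
    classical
    ext d
    by_cases hd : d = 0
    · simp [hd]
    · rw [hcoeff d hd, coeff_C, if_neg (Ne.symm hd)]
  rw [hC, aeval_C, algebraMap_eq] at h
  rw [hC, C_injective κ k (h.trans C_0.symm), C_0]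

/-- The Jacobian criterion: a relation of least degree among the `f i`, differentiated along the
`v i`, would give a system of relations of smaller degree with invertible matrix. -/
theorem algebraicIndependent_of_jacobian [CharZero k] [Fintype ι] [DecidableEq ι]
    (f : ι → MvPolynomial κ k) (a : κ → k) (v : ι → κ → k)
    (h : ∀ i j, eval a (dirDeriv (v i) (f j)) = if i = j then 1 else 0) :
    AlgebraicIndependent k f := by
  have key : ∀ n : ℕ, ∀ g : MvPolynomial ι k, (∀ d, n ≤ d.degree → coeff d g = 0) →
      aeval f g = 0 → g = 0 := by
    intro n
    induction n with
    | zero => exact fun g hg _ => by ext d; simpa using hg d (Nat.zero_le _)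
    | succ n ih =>
      intro g hg h0
      refine eq_zero_of_pderiv_eq_zero_of_aeval_eq_zero (f := f) (fun i => ih _ ?_ ?_) h0
      · intro d hd
        rw [coeff_pderiv, hg _ (by simpa using hd), zero_mul]
      · let M : Matrix ι ι (MvPolynomial κ k) := Matrix.of fun i j => dirDeriv (v i) (f j)
        have hM : M.det ≠ 0 := by
          intro hdet
          have h1 : (eval a) M.det = 1 := by
            rw [RingHom.map_det]
            convert! Matrix.det_one (n := ι) (R := k)
            ext i j
            simp [M, h, Matrix.one_apply]
          simp [hdet] at h1
        have hker : M.mulVec (fun i => aeval f (pderiv i g)) = 0 := by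
          ext1 i
          have := derivation_aeval (dirDeriv (v i)) f g
          rw [h0, map_zero] at this
          simp only [Matrix.mulVec, dotProduct, M, Matrix.of_apply, Pi.zero_apply]
          rw [this]
          exact Finset.sum_congr rfl fun j _ => mul_comm _ _
        exact congrFun (Matrix.eq_zero_of_mulVec_eq_zero hM hker) i
  rw [algebraicIndependent_iff]
  intro g hg
  refine key (g.totalDegree + 1) g (fun d hd => ?_) hg
  by_contra hne
  have := le_totalDegree (mem_support_iff.mpr hne)
  rw [Finsupp.degree_apply] at hd
  rw [Finsupp.sum] at this
  omega

end Jacobian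

end MvPolynomial

/-! ### The dimension of projective space -/

namespace MvPolynomial

variable {k ι : Type*} [Field k]

theorem aeval_mul_of_isHomogeneous {A : Type*} [CommRing A] [Algebra k A] {f : MvPolynomial ι k}
    {n : ℕ} (hf : f.IsHomogeneous n) (s : A) (w : ι → A) :
    aeval (fun i => s * w i) f = s ^ n * aeval w f := by
  rw [aeval_def, aeval_def, eval₂_eq, eval₂_eq, Finset.mul_sum]
  refine Finset.sum_congr rfl fun d hd => ?_
  have hdeg : ∑ i ∈ d.support, d i = n := by
    rw [← hf (mem_support_iff.mp hd), ← Finsupp.degree_apply,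
      Finsupp.degree_eq_weight_one (R := ℕ)]
    rfl
  simp only [mul_pow, Finset.prod_mul_distrib, Finset.prod_pow_eq_pow_sum, hdeg]
  ring

theorem aeval_mul_eq_sum_homogeneousComponent {A : Type*} [CommRing A] [Algebra k A]
    (f : MvPolynomial ι k) (s : A) (w : ι → A) :
    aeval (fun i => s * w i) f =
      ∑ n ∈ Finset.range (f.totalDegree + 1), s ^ n * aeval w (homogeneousComponent n f) := by
  conv_lhs => rw [← sum_homogeneousComponent f]
  rw [map_sum]
  exact Finset.sum_congr rfl fun n _ =>
    aeval_mul_of_isHomogeneous (homogeneousComponent_isHomogeneous n f) s w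

theorem eval_smul_eq_sum_homogeneousComponent (f : MvPolynomial ι k) (v : ι → k) (t : k) :
    eval (t • v) f =
      ∑ n ∈ Finset.range (f.totalDegree + 1), t ^ n * eval v (homogeneousComponent n f) := by
  exact aeval_mul_eq_sum_homogeneousComponent f t v

/-- A polynomial that vanishes on a line, except possibly at the origin, has all its homogeneous
components vanishing on it. -/
theorem eval_homogeneousComponent_eq_zero [Infinite k] {f : MvPolynomial ι k} {v : ι → k}
    (h : ∀ t : k, t ≠ 0 → eval (t • v) f = 0) (n : ℕ) :
    eval v (homogeneousComponent n f) = 0 := by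
  let p : Polynomial k := ∑ n ∈ Finset.range (f.totalDegree + 1),
    Polynomial.monomial n (eval v (homogeneousComponent n f))
  have hp : p = 0 := by
    refine Polynomial.eq_zero_of_infinite_isRoot p (Set.Infinite.mono (s := {0}ᶜ) ?_ ?_)
    · intro t ht
      have := h t ht
      rw [eval_smul_eq_sum_homogeneousComponent] at this
      simpa [p, Polynomial.eval_finsetSum, mul_comm] using this
    · exact (Set.finite_singleton (0 : k)).infinite_compl
  by_cases hn : n ∈ Finset.range (f.totalDegree + 1)
  · have h1 : p.coeff n = 0 := by rw [hp, Polynomial.coeff_zero]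
    simpa [p, Polynomial.finsetSum_coeff, Polynomial.coeff_monomial, hn] using h1
  · rw [homogeneousComponent_eq_zero _ _ (by simpa [Nat.lt_succ_iff] using hn), map_zero]

end MvPolynomial

namespace ProjSpace

open MvPolynomial TopologicalSpace

section VanishingIdeal

variable {k ι : Type*} [Field k]

theorem exists_eq_mk (p : ProjSpace k ι) : ∃ (v : ι → k) (hv : v ≠ 0), p = mk v hv :=
  ⟨p.rep, Projectivization.rep_nonzero p, (Projectivization.mk_rep p).symm⟩

theorem mk_smul (v : ι → k) (hv : v ≠ 0) (t : k) (htv : t • v ≠ 0) : mk (t • v) htv = mk v hv :=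
  (Projectivization.mk_eq_mk_iff' k _ _ _ _).mpr ⟨t, rfl⟩

/-- The ideal of all polynomials, homogeneous or not, that vanish on the affine cone over a subset
of projective space (without the origin). -/
def vanishingIdeal (Z : Set (ProjSpace k ι)) : Ideal (MvPolynomial ι k) where
  carrier := {f | ∀ (v : ι → k) (hv : v ≠ 0), mk v hv ∈ Z → eval v f = 0}
  add_mem' hf hg v hv hZ := by rw [map_add, hf v hv hZ, hg v hv hZ, add_zero]
  zero_mem' v _ _ := map_zero _
  smul_mem' c f hf v hv hZ := by rw [smul_eq_mul, map_mul, hf v hv hZ, mul_zero]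

theorem vanishingIdeal_antitone {Z W : Set (ProjSpace k ι)} (h : Z ⊆ W) :
    vanishingIdeal W ≤ vanishingIdeal Z :=
  fun _ hf v hv hZ => hf v hv (h hZ)

theorem subset_zeroLocus_iff {Z : Set (ProjSpace k ι)} {S : Set (MvPolynomial ι k)}
    (hS : ∀ f ∈ S, ∃ n, f.IsHomogeneous n) :
    Z ⊆ zeroLocus S ↔ S ⊆ vanishingIdeal Z := by
  constructor
  · intro h f hf v hv hZ
    exact (mk_mem_zeroLocus hS v hv).mp (h hZ) f hf
  · intro h p hp
    obtain ⟨v, hv, rfl⟩ := exists_eq_mk p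
    exact (mk_mem_zeroLocus hS v hv).mpr fun f hf => h hf v hv hp

theorem isClosed_zeroLocus {S : Set (MvPolynomial ι k)} (hS : ∀ f ∈ S, ∃ n, f.IsHomogeneous n) :
    IsClosed (zeroLocus S) :=
  (isClosed_iff _).mpr ⟨S, hS, rfl⟩

theorem le_of_vanishingIdeal_le {Z W : Set (ProjSpace k ι)} (hW : IsClosed W)
    (h : vanishingIdeal W ≤ vanishingIdeal Z) : Z ⊆ W := by
  obtain ⟨S, hS, rfl⟩ := (isClosed_iff W).mp hW
  exact (subset_zeroLocus_iff hS).mpr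
    (((subset_zeroLocus_iff hS).mp subset_rfl).trans h)

/-- Forms that vanish on a set vanish on its closure. -/
theorem mem_vanishingIdeal_closure {Z : Set (ProjSpace k ι)} {f : MvPolynomial ι k} {n : ℕ}
    (hf : f.IsHomogeneous n) (h : f ∈ vanishingIdeal Z) : f ∈ vanishingIdeal (closure Z) := by
  have hS : ∀ g ∈ ({f} : Set (MvPolynomial ι k)), ∃ n, g.IsHomogeneous n := by
    rintro g rfl
    exact ⟨n, hf⟩
  have := closure_minimal ((subset_zeroLocus_iff hS (Z := Z)).mpr (by simpa using h))
    (isClosed_zeroLocus hS)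
  exact (subset_zeroLocus_iff hS).mp this rfl

theorem homogeneousComponent_mem_vanishingIdeal [Infinite k] {Z : Set (ProjSpace k ι)}
    {f : MvPolynomial ι k} (hf : f ∈ vanishingIdeal Z) (n : ℕ) :
    homogeneousComponent n f ∈ vanishingIdeal Z := by
  intro v hv hZ
  refine eval_homogeneousComponent_eq_zero (fun t ht => ?_) n
  have htv : t • v ≠ 0 := smul_ne_zero ht hv
  exact hf _ htv (by rwa [mk_smul v hv])

attribute [local instance] MvPolynomial.gradedAlgebra in
theorem isPrime_vanishingIdeal [Infinite k] {Z : Set (ProjSpace k ι)} (hZ : IsIrreducible Z) :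
    (vanishingIdeal Z).IsPrime := by
  have hhom : (vanishingIdeal Z).IsHomogeneous (homogeneousSubmodule ι k) := by
    intro n f hf
    rw [show (DirectSum.decompose (homogeneousSubmodule ι k) f n : MvPolynomial ι k) =
      homogeneousComponent n f from decomposition.decompose'_apply f n]
    exact homogeneousComponent_mem_vanishingIdeal hf n
  refine hhom.isPrime_of_homogeneous_mem_or_mem ?_ ?_
  · obtain ⟨p, hp⟩ := hZ.nonempty
    obtain ⟨v, hv, rfl⟩ := exists_eq_mk p
    intro htop
    have h1 : (1 : MvPolynomial ι k) ∈ vanishingIdeal Z := htop ▸ Submodule.mem_top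
    simpa using h1 v hv hp
  · rintro f g ⟨m, hf⟩ ⟨n, hg⟩ hfg
    have hSf : ∀ q ∈ ({f} : Set (MvPolynomial ι k)), ∃ n, q.IsHomogeneous n := by
      rintro q rfl
      exact ⟨m, hf⟩
    have hSg : ∀ q ∈ ({g} : Set (MvPolynomial ι k)), ∃ n, q.IsHomogeneous n := by
      rintro q rfl
      exact ⟨n, hg⟩
    have hcov : Z ⊆ zeroLocus {f} ∪ zeroLocus {g} := by
      intro p hp
      obtain ⟨v, hv, rfl⟩ := exists_eq_mk p
      have := hfg v hv hp
      rw [map_mul, mul_eq_zero] at this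
      rw [Set.mem_union, mk_mem_zeroLocus hSf, mk_mem_zeroLocus hSg]
      simpa using this
    rcases isPreirreducible_iff_isClosed_union_isClosed.mp hZ.isPreirreducible _ _
      (isClosed_zeroLocus hSf) (isClosed_zeroLocus hSg) hcov with h | h
    · exact Or.inl ((subset_zeroLocus_iff hSf).mp h rfl)
    · exact Or.inr ((subset_zeroLocus_iff hSg).mp h rfl)

/-- The maximal ideal of the origin of affine space. -/
noncomputable def originIdeal (k ι : Type*) [Field k] : Ideal (MvPolynomial ι k) :=
  RingHom.ker (eval (0 : ι → k))

instance : (originIdeal k ι).IsPrime :=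
  RingHom.ker_isPrime _

theorem vanishingIdeal_lt_originIdeal [Infinite k] {Z : Set (ProjSpace k ι)} (hZ : Z.Nonempty) :
    vanishingIdeal Z < originIdeal k ι := by
  obtain ⟨p, hp⟩ := hZ
  obtain ⟨v, hv, rfl⟩ := exists_eq_mk p
  refine lt_of_le_of_ne (fun f hf => ?_) fun heq => ?_
  · have h0 := homogeneousComponent_mem_vanishingIdeal hf 0 v hv hp
    rw [homogeneousComponent_zero, eval_C] at h0
    rw [originIdeal, RingHom.mem_ker]
    simpa [eval_zero, constantCoeff_eq] using h0
  · obtain ⟨i, hi⟩ := Function.ne_iff.mp hv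
    have h1 : (X i : MvPolynomial ι k) ∈ vanishingIdeal Z := by
      rw [heq, originIdeal, RingHom.mem_ker]
      simp
    exact hi (by simpa using h1 v hv hp)

/-- Sending a nonempty irreducible closed set to its ideal, and the empty set (as the new smallest
element) to the ideal of the origin, reverses strict inclusions. -/
theorem krullDim_irreducibleCloseds_add_one_le [Infinite k] [Finite ι] [Nonempty ι] :
    Order.krullDim (IrreducibleCloseds (ProjSpace k ι)) + 1 ≤ Nat.card ι := by
  have : Nonempty (IrreducibleCloseds (ProjSpace k ι)) := by
    have v : ProjSpace k ι := mk 1 one_ne_zero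
    exact ⟨⟨closure {v}, isIrreducible_singleton.closure, isClosed_closure⟩⟩
  -- `⊥` stands for the empty set, whose vanishing ideal is replaced by the ideal of the origin.
  let F : WithBot (IrreducibleCloseds (ProjSpace k ι)) → (PrimeSpectrum (MvPolynomial ι k))ᵒᵈ :=
    fun Z => OrderDual.toDual <| match Z with
      | ⊥ => ⟨originIdeal k ι, inferInstance⟩
      | (Z : IrreducibleCloseds (ProjSpace k ι)) =>
        ⟨vanishingIdeal (Z : Set (ProjSpace k ι)), isPrime_vanishingIdeal Z.isIrreducible⟩
  have hF : StrictMono F := by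
    intro Z W hZW
    rw [← OrderDual.ofDual_lt_ofDual, ← PrimeSpectrum.asIdeal_lt_asIdeal]
    induction W using WithBot.recBotCoe with
    | bot => exact absurd hZW not_lt_bot
    | coe W =>
      induction Z using WithBot.recBotCoe with
      | bot => exact vanishingIdeal_lt_originIdeal W.isIrreducible.nonempty
      | coe Z =>
        have h := WithBot.coe_lt_coe.mp hZW
        exact lt_of_le_not_ge (vanishingIdeal_antitone h.le) fun hle =>
          h.not_ge (le_of_vanishingIdeal_le Z.isClosed hle)
  have h1 := Order.krullDim_le_of_strictMono F hF
  rw [Order.krullDim_orderDual, Order.krullDim_withBot] at h1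
  refine h1.trans ?_
  have h2 := MvPolynomial.ringKrullDim_of_isNoetherianRing (R := k) (ι := ι)
  rw [ringKrullDim_eq_zero_of_field, zero_add] at h2
  exact h2.le

end VanishingIdeal

end ProjSpace

/-! ### Parametrised projective varieties -/

namespace MvPolynomial

variable {k ι τ : Type*} [Field k]

theorem aeval_mem {A : Type*} [CommRing A] [Algebra k A] {S : Subalgebra k A} {f : ι → A}
    (hf : ∀ i, f i ∈ S) (p : MvPolynomial ι k) : aeval f p ∈ S := by
  have h : Algebra.adjoin k (Set.range f) ≤ S :=
    Algebra.adjoin_le (Set.range_subset_iff.mpr hf)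
  rw [Algebra.adjoin_range_eq_range_aeval] at h
  exact h ⟨p, rfl⟩

variable [DecidableEq τ]

/-- Substituting the coordinates of the point `a` for the variables outside of `T`. -/
noncomputable def freeze (a : τ → k) (T : Finset τ) : MvPolynomial τ k →ₐ[k] MvPolynomial τ k :=
  aeval fun t => if t ∈ T then X t else C (a t)

theorem eval_freeze (a b : τ → k) (T : Finset τ) (p : MvPolynomial τ k) :
    eval b (freeze a T p) = eval (T.piecewise b a) p := by
  rw [freeze, eval_aeval]
  congr 2
  ext t
  by_cases ht : t ∈ T <;> simp [ht]

theorem eval_freeze_self (a : τ → k) (T : Finset τ) (p : MvPolynomial τ k) :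
    eval a (freeze a T p) = eval a p := by
  rw [eval_freeze, Finset.piecewise_same]

theorem eval_dirDeriv_freeze (a v : τ → k) (T : Finset τ) (p : MvPolynomial τ k) :
    eval a (dirDeriv v (freeze a T p)) = eval a (dirDeriv (T.piecewise v 0) p) := by
  rw [freeze, eval_dirDeriv_aeval]
  have h1 : (fun t => eval a (if t ∈ T then X t else C (a t))) = a := by
    ext t
    by_cases ht : t ∈ T <;> simp [ht]
  have h2 : (fun t => eval a (dirDeriv v (if t ∈ T then X t else C (a t)))) =
      T.piecewise v 0 := by
    ext t
    by_cases ht : t ∈ T <;> simp [ht]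
  rw [h1, h2]

theorem freeze_mem_supported (a : τ → k) (T : Finset τ) (p : MvPolynomial τ k) :
    freeze a T p ∈ supported k (T : Set τ) := by
  refine aeval_mem (fun t => ?_) p
  split_ifs with ht
  · exact X_mem_supported.mpr ht
  · exact Subalgebra.algebraMap_mem _ _

end MvPolynomial

namespace ProjSpace

open MvPolynomial TopologicalSpace

section Param

variable {k ι τ : Type*} [Field k]

/-- The set of the points with homogeneous coordinates `h(b)`, where `b` runs through the points of
affine space with `h(b) ≠ 0`. -/
def paramLocus (h : ι → MvPolynomial τ k) : Set (ProjSpace k ι) :=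
  {p | ∃ (b : τ → k) (hb : (fun i => eval b (h i)) ≠ 0), p = mk _ hb}

theorem mem_vanishingIdeal_paramLocus [Infinite k] {h : ι → MvPolynomial τ k} (h0 : h ≠ 0)
    {f : MvPolynomial ι k} {n : ℕ} (hf : f.IsHomogeneous n) :
    f ∈ vanishingIdeal (paramLocus h) ↔ aeval h f = 0 := by
  constructor
  · intro hv
    obtain ⟨i, hi⟩ := Function.ne_iff.mp h0
    -- A form of degree `0` need not vanish at the points `b` with `h(b) = 0`.
    have hmul : aeval h f * h i = 0 := by
      refine MvPolynomial.funext fun b => ?_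
      rw [map_mul, eval_aeval, map_zero]
      by_cases hb : (fun i => eval b (h i)) = 0
      · rw [show eval b (h i) = 0 from congrFun hb i, mul_zero]
      · rw [hv _ hb ⟨b, hb, rfl⟩, zero_mul]
    exact (mul_eq_zero.mp hmul).resolve_right hi
  · rintro h1 v hv ⟨b, hb, heq⟩
    obtain ⟨t, ht⟩ := (Projectivization.mk_eq_mk_iff' k _ _ _ _).mp heq
    have h2 := aeval_mul_of_isHomogeneous hf t fun i => eval b (h i)
    have h3 : eval (t • fun i => eval b (h i)) f = t ^ n * eval (fun i => eval b (h i)) f := h2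
    rw [ht, ← eval_aeval, h1, map_zero, mul_zero] at h3
    exact h3

theorem mem_vanishingIdeal_closure_paramLocus [Infinite k] {h : ι → MvPolynomial τ k} (h0 : h ≠ 0)
    {f : MvPolynomial ι k} {n : ℕ} (hf : f.IsHomogeneous n) :
    f ∈ vanishingIdeal (closure (paramLocus h)) ↔ aeval h f = 0 := by
  rw [← mem_vanishingIdeal_paramLocus h0 hf]
  exact ⟨fun h1 => vanishingIdeal_antitone subset_closure h1, mem_vanishingIdeal_closure hf⟩

theorem paramLocus_nonempty [Infinite k] {h : ι → MvPolynomial τ k} (h0 : h ≠ 0) :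
    (paramLocus h).Nonempty := by
  obtain ⟨i, hi⟩ := Function.ne_iff.mp h0
  have : ∃ b, eval b (h i) ≠ 0 := by
    by_contra! hcon
    exact hi (MvPolynomial.funext fun b => by simpa using hcon b)
  obtain ⟨b, hb⟩ := this
  exact ⟨_, b, fun h1 => hb (congrFun h1 i), rfl⟩

theorem isIrreducible_paramLocus [Infinite k] {h : ι → MvPolynomial τ k} (h0 : h ≠ 0) :
    IsIrreducible (paramLocus h) := by
  refine ⟨paramLocus_nonempty h0, isPreirreducible_iff_isClosed_union_isClosed.mpr ?_⟩
  intro Z W hZ hW hcov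
  obtain ⟨S, hS, rfl⟩ := (isClosed_iff Z).mp hZ
  obtain ⟨T, hT, rfl⟩ := (isClosed_iff W).mp hW
  rw [subset_zeroLocus_iff hS, subset_zeroLocus_iff hT]
  by_contra! hcon
  obtain ⟨⟨f, hf, hf0⟩, ⟨g, hg, hg0⟩⟩ :=
    And.intro (Set.not_subset.mp hcon.1) (Set.not_subset.mp hcon.2)
  obtain ⟨m, hm⟩ := hS f hf
  obtain ⟨n, hn⟩ := hT g hg
  have hfg : f * g ∈ vanishingIdeal (paramLocus h) := by
    intro v hv hp
    rcases hcov hp with h1 | h1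
    · rw [map_mul, (mk_mem_zeroLocus hS v hv).mp h1 f hf, zero_mul]
    · rw [map_mul, (mk_mem_zeroLocus hT v hv).mp h1 g hg, mul_zero]
  rw [mem_vanishingIdeal_paramLocus h0 (hm.mul hn), map_mul, mul_eq_zero,
    ← mem_vanishingIdeal_paramLocus h0 hm, ← mem_vanishingIdeal_paramLocus h0 hn] at hfg
  exact hfg.elim hf0 hg0

/-- The closure of a parametrised set as an irreducible closed set. -/
def paramVariety [Infinite k] (h : ι → MvPolynomial τ k) (h0 : h ≠ 0) :
    IrreducibleCloseds (ProjSpace k ι) :=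
  ⟨closure (paramLocus h), (isIrreducible_paramLocus h0).closure, isClosed_closure⟩

/-- The parametrisation of the affine cone over a parametrised projective variety: the additional
variable `none` is a scaling factor. -/
noncomputable def coneParam (h : ι → MvPolynomial τ k) (i : ι) : MvPolynomial (Option τ) k :=
  X none * rename some (h i)

theorem aeval_coneParam_eq_zero_iff [Infinite k] (h : ι → MvPolynomial τ k)
    (f : MvPolynomial ι k) :
    aeval (coneParam h) f = 0 ↔ ∀ n, aeval h (homogeneousComponent n f) = 0 := by
  have heval : ∀ (t : k) (b : τ → k),
      eval (fun o : Option τ => o.elim t b) (aeval (coneParam h) f) =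
        eval (t • fun i => eval b (h i)) f := by
    intro t b
    rw [eval_aeval]
    congr 2
    ext i
    simp [coneParam, eval_rename, Function.comp_def]
  constructor
  · intro h0 n
    refine MvPolynomial.funext fun b => ?_
    rw [eval_aeval, map_zero]
    refine eval_homogeneousComponent_eq_zero (fun t _ => ?_) n
    rw [← heval, h0, map_zero]
  · intro h0
    refine MvPolynomial.funext fun b => ?_
    have hb : b = fun o : Option τ => o.elim (b none) fun t => b (some t) := by
      ext o
      cases o <;> rfl
    rw [hb, heval, eval_smul_eq_sum_homogeneousComponent, map_zero]
    refine Finset.sum_eq_zero fun n _ => ?_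
    rw [← eval_aeval, h0 n, map_zero, mul_zero]

theorem aeval_coneParam_eq_zero_of_vanishingIdeal_le [Infinite k] {τ' : Type*}
    {h : ι → MvPolynomial τ k} {h' : ι → MvPolynomial τ' k} (h0 : h ≠ 0) (h0' : h' ≠ 0)
    (hle : vanishingIdeal (closure (paramLocus h)) ≤ vanishingIdeal (closure (paramLocus h')))
    {f : MvPolynomial ι k} (hf : aeval (coneParam h) f = 0) : aeval (coneParam h') f = 0 := by
  rw [aeval_coneParam_eq_zero_iff] at hf ⊢
  intro n
  rw [← mem_vanishingIdeal_closure_paramLocus h0' (homogeneousComponent_isHomogeneous n f)]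
  exact hle ((mem_vanishingIdeal_closure_paramLocus h0
    (homogeneousComponent_isHomogeneous n f)).mpr (hf n))

theorem eval_dirDeriv_coneParam (h : ι → MvPolynomial τ k) (a : τ → k) (w : Option τ → k) (i : ι) :
    eval (fun o : Option τ => o.elim 1 a) (dirDeriv w (coneParam h i)) =
      w none * eval a (h i) + eval a (dirDeriv (fun t => w (some t)) (h i)) := by
  have h1 : rename some (h i) =
      aeval (fun t => (X (some t) : MvPolynomial (Option τ) k)) (h i) := by
    rw [rename_eq_aeval]
    rfl
  rw [coneParam, dirDeriv_mul, map_add, map_mul, map_mul, h1, eval_dirDeriv_aeval, eval_aeval]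
  simp only [eval_X, dirDeriv_X, eval_C, Option.elim_none, Option.elim_some]
  ring

/-- The differential, at the point with scaling factor `1` over `a`, of the parametrisation of the
affine cone. -/
noncomputable def coneDifferential (h : ι → MvPolynomial τ k) (a : τ → k) :
    (Option τ → k) →ₗ[k] (ι → k) where
  toFun w i := w none * eval a (h i) + eval a (dirDeriv (fun t => w (some t)) (h i))
  map_add' v w := by
    ext i
    have := dirDeriv_add_vector (fun t => v (some t)) (fun t => w (some t)) (h i)
    simp only [Pi.add_def] at this
    simp only [Pi.add_apply, this, map_add]
    ring
  map_smul' c v := by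
    ext i
    have := dirDeriv_smul_vector c (fun t => v (some t)) (h i)
    simp only [Pi.smul_def, smul_eq_mul] at this
    simp only [Pi.smul_apply, this, smul_eval, RingHom.id_apply, smul_eq_mul]
    ring

variable [DecidableEq τ]

theorem freeze_ne_zero {h : ι → MvPolynomial τ k} {a : τ → k}
    (hJ : Function.Injective (coneDifferential h a)) (T : Finset τ) :
    (fun i => freeze a T (h i)) ≠ 0 := by
  intro h0
  -- If `h` vanished at `a`, the differential would kill the direction of the scaling factor.
  have h1 : coneDifferential h a (fun o => o.elim 1 0) = 0 := by
    ext i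
    have h2 : eval a (h i) = 0 := by
      rw [← eval_freeze_self a T, show freeze a T (h i) = 0 from congrFun h0 i, map_zero]
    have h3 : dirDeriv (fun _ : τ => (0 : k)) (h i) = 0 := by
      have := dirDeriv_smul_vector (0 : k) (fun _ : τ => (0 : k)) (h i)
      rwa [zero_smul, zero_smul] at this
    simp [coneDifferential, h2, h3]
  have h2 := hJ (h1.trans (map_zero _).symm)
  simpa using congrFun h2 none

theorem paramLocus_freeze_mono (h : ι → MvPolynomial τ k) (a : τ → k) {S T : Finset τ}
    (hST : S ⊆ T) :
    paramLocus (fun i => freeze a S (h i)) ⊆ paramLocus (fun i => freeze a T (h i)) := by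
  rintro _ ⟨b, hb, rfl⟩
  have heq : (fun i => eval (S.piecewise b a) (freeze a T (h i))) =
      fun i => eval b (freeze a S (h i)) := by
    ext i
    rw [eval_freeze, eval_freeze]
    congr 2
    ext t
    by_cases hS : t ∈ S
    · simp [hS, hST hS]
    · by_cases hT : t ∈ T <;> simp [hS, hT]
  refine ⟨S.piecewise b a, heq ▸ hb, ?_⟩
  simp only [heq]

/-- If the differential of the cone is injective at `a`, then so are its restrictions to coordinate
subspaces through `a`, and there are `|T| + 1` linear forms which become algebraically independent
on the cone over the variety with parameters `T`. -/
theorem exists_algebraicIndependent_coneParam_freeze [CharZero k] [Finite ι] [Fintype τ]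
    {h : ι → MvPolynomial τ k} {a : τ → k} (hJ : Function.Injective (coneDifferential h a))
    (T : Finset τ) :
    ∃ p : {o : Option τ // o ∈ T.insertNone} → MvPolynomial ι k,
      AlgebraicIndependent k fun o => aeval (coneParam fun i => freeze a T (h i)) (p o) := by
  have := Fintype.ofFinite ι
  classical
  obtain ⟨L, hL⟩ := (coneDifferential h a).exists_leftInverse_of_injective
    (LinearMap.ker_eq_bot.mpr hJ)
  -- The linear forms are the components of a left inverse of the differential.
  refine ⟨fun o => ∑ i, C (L (Pi.single i 1) o) * X i,
    algebraicIndependent_of_jacobian _ (fun o : Option τ => o.elim 1 a)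
      (fun o => Pi.single (o : Option τ) 1) fun o o' => ?_⟩
  have hfreeze : coneDifferential (fun i => freeze a T (h i)) a (Pi.single (o : Option τ) 1) =
      coneDifferential h a (Pi.single (o : Option τ) 1) := by
    ext i
    simp only [coneDifferential, LinearMap.coe_mk, AddHom.coe_mk, eval_freeze_self,
      eval_dirDeriv_freeze]
    congr 4
    ext t
    by_cases ht : t ∈ T
    · simp [ht]
    · have hne : some t ≠ (o : Option τ) := by
        intro heq
        exact ht (Finset.some_mem_insertNone.mp (heq ▸ o.2))
      simp [ht, hne]
  have h1 : ∀ i, eval (fun o : Option τ => o.elim 1 a)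
      (dirDeriv (Pi.single (o : Option τ) 1) (coneParam (fun i => freeze a T (h i)) i)) =
      coneDifferential h a (Pi.single (o : Option τ) 1) i := by
    intro i
    rw [eval_dirDeriv_coneParam, ← hfreeze]
    rfl
  have h2 : L (coneDifferential h a (Pi.single (o : Option τ) 1)) = Pi.single (o : Option τ) 1 :=
    LinearMap.congr_fun hL _
  simp only [map_sum, map_mul, aeval_X, algHom_C, algebraMap_eq, dirDeriv_mul, derivation_C,
    mul_zero, add_zero, eval_C, h1]
  have h3 := congrFun (congrArg L (pi_eq_sum_univ' (coneDifferential h a (Pi.single o.1 1)))) o'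
  rw [h2, map_sum, Finset.sum_apply] at h3
  have h4 : (Pi.single (o : Option τ) (1 : k) : Option τ → k) o' = if o = o' then 1 else 0 := by
    simp only [Pi.single_apply, Subtype.ext_iff, eq_comm (a := (o' : Option τ))]
  rw [← h4, h3]
  refine Finset.sum_congr rfl fun i _ => ?_
  rw [map_smul, Pi.smul_apply, smul_eq_mul, mul_comm]

/-- The number of algebraically independent functions on the affine cone distinguishes the
varieties with different numbers of parameters. -/
theorem paramVariety_freeze_strictMono [CharZero k] [Finite ι] [Fintype τ]
    {h : ι → MvPolynomial τ k} {a : τ → k} (hJ : Function.Injective (coneDifferential h a)) :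
    StrictMono fun T : Finset τ =>
      paramVariety (fun i => freeze a T (h i)) (freeze_ne_zero hJ T) := by
  intro S T hST
  refine lt_of_le_not_ge (closure_mono (paramLocus_freeze_mono h a hST.1)) fun hge => ?_
  obtain ⟨p, hp⟩ := exists_algebraicIndependent_coneParam_freeze hJ T
  have hmem : ∀ q : MvPolynomial ι k, aeval (coneParam fun i => freeze a S (h i)) q ∈
      supported k (S.insertNone : Set (Option τ)) := by
    refine fun q => aeval_mem (fun i => ?_) q
    refine Subalgebra.mul_mem _ (X_mem_supported.mpr (by simp)) ?_
    have h1 := freeze_mem_supported a S (h i)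
    rw [mem_supported] at h1 ⊢
    classical
    intro o ho
    obtain ⟨t, ht, rfl⟩ := Finset.mem_image.mp (vars_rename some _ ho)
    exact Finset.mem_coe.mpr (Finset.some_mem_insertNone.mpr (h1 ht))
  -- Equal varieties have the same relations on their cones, so the `|T| + 1` functions would be
  -- independent in a polynomial ring in `|S| + 1` variables.
  have hS : AlgebraicIndependent k fun o =>
      (⟨aeval (coneParam fun i => freeze a S (h i)) (p o), hmem _⟩ :
        supported k (S.insertNone : Set (Option τ))) := by
    rw [← AlgHom.algebraicIndependent_iff (supported k (S.insertNone : Set (Option τ))).val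
      Subtype.val_injective]
    rw [algebraicIndependent_iff] at hp ⊢
    intro q hq
    have hcomp : ∀ g : ι → MvPolynomial (Option τ) k,
        aeval g (aeval p q) = aeval (fun o => aeval g (p o)) q := fun g =>
      comp_aeval_apply p (aeval g) q
    refine hp q ?_
    rw [← hcomp]
    refine aeval_coneParam_eq_zero_of_vanishingIdeal_le (freeze_ne_zero hJ S) (freeze_ne_zero hJ T)
      (vanishingIdeal_antitone hge) ?_
    rw [hcomp]
    exact hq
  have hS' := hS.map' (f := (supportedEquivMvPolynomial (R := k)
    (S.insertNone : Set (Option τ))).toAlgHom) (AlgEquiv.injective _)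
  have hcard := hS'.lift_cardinalMk_le_trdeg
  rw [MvPolynomial.trdeg_of_isDomain] at hcard
  have h1 : T.insertNone.card ≤ S.insertNone.card := by
    simpa only [Finset.mem_coe, Cardinal.mk_coe_finset, Finset.coe_sort_coe, Cardinal.lift_natCast,
      Nat.cast_le] using hcard
  rw [Finset.card_insertNone, Finset.card_insertNone] at h1
  exact absurd (Finset.card_lt_card hST) (by omega)

end Param

end ProjSpace

/-! ### The dimension and the codimension of a parametrised projective variety -/

theorem Finset.card_le_order_height {τ : Type*} (T : Finset τ) :
    (T.card : ℕ∞) ≤ Order.height T := by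
  classical
  induction T using Finset.induction_on with
  | empty => simp
  | insert t T ht ih =>
    rw [Finset.card_insert_of_notMem ht, Nat.cast_add, Nat.cast_one]
    exact (add_le_add_left ih 1).trans (Order.height_add_one_le (Finset.ssubset_insert ht))

theorem Finset.card_compl_le_order_coheight {τ : Type*} [Fintype τ] [DecidableEq τ]
    (T : Finset τ) : (Tᶜ.card : ℕ∞) ≤ Order.coheight T := by
  induction h : Tᶜ using Finset.induction_on generalizing T with
  | empty => simp
  | insert t U ht ih =>
    have hT : t ∉ T := by
      rw [← Finset.mem_compl, h]
      exact Finset.mem_insert_self t U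
    rw [Finset.card_insert_of_notMem ht, Nat.cast_add, Nat.cast_one]
    refine (add_le_add_left (ih (insert t T) ?_) 1).trans
      (Order.coheight_add_one_le (Finset.ssubset_insert hT))
    rw [Finset.compl_insert, h, Finset.erase_insert ht]

namespace TopologicalSpace.IrreducibleCloseds

/-- The Krull dimension of an irreducible closed subset is its height in the order of irreducible
closed subsets. -/
theorem topologicalKrullDim_eq_height {X : Type*} [TopologicalSpace X] (Z : IrreducibleCloseds X) :
    topologicalKrullDim (Z : Set X) = Order.height Z := by
  rw [Order.height_eq_krullDim_Iic, topologicalKrullDim]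
  apply le_antisymm
  · let F : IrreducibleCloseds (Z : Set X) → Set.Iic Z := fun W =>
      ⟨map Subtype.val continuous_subtype_val W,
        closure_minimal (by rintro _ ⟨w, -, rfl⟩; exact w.2) Z.isClosed⟩
    refine Order.krullDim_le_of_strictMono F fun V W hVW => ?_
    exact map_strictMono_of_isInducing Topology.IsInducing.subtypeVal hVW
  · have himage : ∀ W : Set.Iic Z,
        Subtype.val '' (Subtype.val ⁻¹' (W.1 : Set X) : Set (Z : Set X)) = (W.1 : Set X) := by
      intro W
      rw [Subtype.image_preimage_coe]
      exact Set.inter_eq_right.mpr W.2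
    let G : Set.Iic Z → IrreducibleCloseds (Z : Set X) := fun W =>
      { carrier := Subtype.val ⁻¹' (W.1 : Set X)
        isIrreducible' := by
          have hW := W.1.isIrreducible
          rw [← himage W] at hW
          refine ⟨hW.nonempty.of_image, isPreirreducible_iff_isClosed_union_isClosed.mpr ?_⟩
          intro A B hA hB hcov
          obtain ⟨A, hA', rfl⟩ := isClosed_induced_iff.mp hA
          obtain ⟨B, hB', rfl⟩ := isClosed_induced_iff.mp hB
          simpa only [Set.image_subset_iff] using
            isPreirreducible_iff_isClosed_union_isClosed.mp hW.isPreirreducible A B hA' hB'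
              (Set.image_subset_iff.mpr hcov)
        isClosed' := W.1.isClosed.preimage continuous_subtype_val }
    refine Order.krullDim_le_of_strictMono G fun V W hVW => ?_
    refine lt_of_le_not_ge (fun x hx => hVW.le hx) fun hle => hVW.not_ge ?_
    have := Set.image_mono (f := Subtype.val) (show (G W : Set (Z : Set X)) ⊆ G V from hle)
    change Subtype.val '' (Subtype.val ⁻¹' (W.1 : Set X) : Set (Z : Set X)) ⊆
      Subtype.val '' (Subtype.val ⁻¹' (V.1 : Set X) : Set (Z : Set X)) at this
    rw [himage, himage] at this
    exact this

end TopologicalSpace.IrreducibleCloseds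

namespace ProjSpace

open MvPolynomial TopologicalSpace

section Dimension

variable {k ι τ : Type*} [Field k]

/-- If a parametrisation of an open part of projective space is unramified at `a`, then freezing
parameters one at a time gives a chain of irreducible closed sets of maximal length. -/
theorem height_and_coheight_paramVariety_freeze [CharZero k] [Fintype ι] [Fintype τ]
    [DecidableEq τ] {h : ι → MvPolynomial τ k} {a : τ → k}
    (hJ : Function.Injective (coneDifferential h a)) (hcard : Fintype.card τ + 1 = Fintype.card ι)
    (T : Finset τ) :
    Order.height (paramVariety (fun i => freeze a T (h i)) (freeze_ne_zero hJ T)) = T.card ∧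
      Order.coheight (paramVariety (fun i => freeze a T (h i)) (freeze_ne_zero hJ T)) =
        Tᶜ.card := by
  have hmono := paramVariety_freeze_strictMono hJ
  set Z := fun T : Finset τ => paramVariety (fun i => freeze a T (h i)) (freeze_ne_zero hJ T)
  change Order.height (Z T) = _ ∧ Order.coheight (Z T) = _
  have h1 : (T.card : ℕ∞) ≤ Order.height (Z T) :=
    T.card_le_order_height.trans (Order.height_le_height_apply_of_strictMono Z hmono T)
  have h2 : (Tᶜ.card : ℕ∞) ≤ Order.coheight (Z T) :=
    T.card_compl_le_order_coheight.trans (Order.coheight_le_coheight_apply_of_strictMono Z hmono T)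
  have : Nonempty ι := Fintype.card_pos_iff.mp (by omega)
  have : Nonempty (IrreducibleCloseds (ProjSpace k ι)) := ⟨Z T⟩
  have h3 : Order.height (Z T) + Order.coheight (Z T) + 1 ≤ T.card + Tᶜ.card + 1 := by
    have hdim := krullDim_irreducibleCloseds_add_one_le (k := k) (ι := ι)
    rw [Order.krullDim_eq_iSup_height_add_coheight_of_nonempty, Nat.card_eq_fintype_card,
      ← hcard, ← T.card_add_card_compl] at hdim
    have hle := le_iSup (fun W : IrreducibleCloseds (ProjSpace k ι) =>
      Order.height W + Order.coheight W) (Z T)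
    refine (add_le_add_left hle 1).trans ?_
    exact_mod_cast hdim
  generalize Order.height (Z T) = x at *
  generalize Order.coheight (Z T) = y at *
  have hx : x ≠ ⊤ := by
    rintro rfl
    simp at h3
  have hy : y ≠ ⊤ := by
    rintro rfl
    simp at h3
  lift x to ℕ using hx
  lift y to ℕ using hy
  norm_cast at *
  omega

/-- A projective variety parametrised by affine space with an injective differential of the cone at
some point has the dimension and codimension that are suggested by the number of parameters.
To see this, complete the parametrisation to one of an open part of projective space by adding
vectors that span a complement of the image of the differential. -/
theorem height_and_coheight_paramVariety [CharZero k] [Fintype ι] [Fintype τ]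
    {h : ι → MvPolynomial τ k} (h0 : h ≠ 0) {a : τ → k}
    (hJ : Function.Injective (coneDifferential h a)) {m : ℕ}
    (hcard : Fintype.card τ + m + 1 = Fintype.card ι) :
    Order.height (paramVariety h h0) = Fintype.card τ ∧
      Order.coheight (paramVariety h h0) = m := by
  classical
  obtain ⟨W, hW⟩ := Submodule.exists_isCompl (LinearMap.range (coneDifferential h a))
  have hrange : Module.finrank k (LinearMap.range (coneDifferential h a)) = Fintype.card τ + 1 := by
    rw [LinearMap.finrank_range_of_inj hJ, Module.finrank_fintype_fun_eq_card, Fintype.card_option]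
  have hWm : Module.finrank k W = m := by
    have := Submodule.finrank_add_eq_of_isCompl hW
    rw [hrange, Module.finrank_fintype_fun_eq_card] at this
    omega
  let w := Module.finBasisOfFinrankEq k W hWm
  -- The vectors are added with new parameters as coefficients, which are zero at the base point.
  let h' : ι → MvPolynomial (τ ⊕ Fin m) k := fun i =>
    rename Sum.inl (h i) + ∑ l, X (Sum.inr l) * C ((w l : ι → k) i)
  let a' : τ ⊕ Fin m → k := Sum.elim a 0
  have hdiff : ∀ v : Option (τ ⊕ Fin m) → k, coneDifferential h' a' v =
      coneDifferential h a (fun o => v (o.map Sum.inl)) +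
        ((∑ l, v (some (Sum.inr l)) • w l : W) : ι → k) := by
    intro v
    ext i
    have h1 : rename Sum.inl (h i) =
        aeval (fun t => (X (Sum.inl t) : MvPolynomial (τ ⊕ Fin m) k)) (h i) := by
      rw [rename_eq_aeval]
      rfl
    simp only [coneDifferential, LinearMap.coe_mk, AddHom.coe_mk, h', map_add, h1,
      eval_dirDeriv_aeval, eval_aeval, map_sum, dirDeriv_mul, dirDeriv_X, derivation_C, map_mul,
      eval_X, eval_C, a', Sum.elim_inl, Sum.elim_inr, Pi.zero_apply, zero_mul, mul_zero,
      Finset.sum_const_zero, add_zero, zero_add, Pi.add_apply, Submodule.coe_sum,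
      Submodule.coe_smul, Finset.sum_apply, Pi.smul_apply, smul_eq_mul, Option.map_none,
      Option.map_some]
    rw [add_assoc]
    congr 2
    exact Finset.sum_congr rfl fun l _ => mul_comm _ _
  have hJ' : Function.Injective (coneDifferential h' a') := by
    rw [← LinearMap.ker_eq_bot, LinearMap.ker_eq_bot']
    intro v hv
    rw [hdiff] at hv
    have hmem : ((∑ l, v (some (Sum.inr l)) • w l : W) : ι → k) ∈
        LinearMap.range (coneDifferential h a) := by
      rw [← neg_eq_of_add_eq_zero_right hv]
      exact Submodule.neg_mem _ ⟨_, rfl⟩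
    have hzero : (∑ l, v (some (Sum.inr l)) • w l : W) = 0 :=
      Subtype.ext (Submodule.disjoint_def.mp hW.disjoint _ hmem (Submodule.coe_mem _))
    have hinr : ∀ l, v (some (Sum.inr l)) = 0 :=
      Fintype.linearIndependent_iff.mp w.linearIndependent _ hzero
    rw [hzero, Submodule.coe_zero, add_zero] at hv
    have hinl := hJ (hv.trans (map_zero _).symm)
    ext o
    rcases o with _ | t | l
    · exact congrFun hinl none
    · exact congrFun hinl (some t)
    · exact hinr l
  have hlocus : paramLocus (fun i => freeze a' (Finset.univ.map Function.Embedding.inl) (h' i)) =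
      paramLocus h := by
    have heval : ∀ b : τ ⊕ Fin m → k,
        (fun i => eval b (freeze a' (Finset.univ.map Function.Embedding.inl) (h' i))) =
          fun i => eval (fun t => b (Sum.inl t)) (h i) := by
      intro b
      ext i
      rw [eval_freeze]
      simp [h', a', eval_rename, Function.comp_def, Finset.piecewise]
    ext p
    constructor
    · rintro ⟨b, hb, rfl⟩
      exact ⟨fun t => b (Sum.inl t), heval b ▸ hb, by simp only [heval]⟩
    · rintro ⟨b, hb, rfl⟩
      have hb' := heval (Sum.elim b 0)
      simp only [Sum.elim_inl] at hb'
      exact ⟨Sum.elim b 0, hb' ▸ hb, by simp only [hb']⟩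
  have hmain := height_and_coheight_paramVariety_freeze hJ' (by simpa using hcard)
    (Finset.univ.map Function.Embedding.inl)
  have hZ : paramVariety (fun i => freeze a' (Finset.univ.map Function.Embedding.inl) (h' i))
      (freeze_ne_zero hJ' _) = paramVariety h h0 :=
    IrreducibleCloseds.ext (congrArg closure hlocus)
  rw [hZ] at hmain
  simpa [Finset.card_compl] using hmain

end Dimension

end ProjSpace

/-! ### Determinants of pencils of symmetric matrices -/

open MvPolynomial

section Pencil

variable {S : Type*} [CommRing S]

/-- The form `det (A₀ x₀ + A₁ x₁ + A₂ x₂ + A₃ x₃)` over an arbitrary commutative ring. -/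
noncomputable def pencilDet (A : Fin 4 → Matrix (Fin 4) (Fin 4) S) : MvPolynomial (Fin 4) S :=
  (∑ i, (X i : MvPolynomial (Fin 4) S) • (A i).map C).det

/-- The coefficients of `det (A₀ x₀ + A₁ x₁ + A₂ x₂ + A₃ x₃)`. -/
noncomputable def pencilCoeff (A : Fin 4 → Matrix (Fin 4) (Fin 4) S) (d : QuarticMonomial) : S :=
  coeff d.1 (pencilDet A)

theorem map_pencilDet {S' : Type*} [CommRing S'] (g : S →+* S')
    (A : Fin 4 → Matrix (Fin 4) (Fin 4) S) :
    map g (pencilDet A) = pencilDet fun i => (A i).map g := by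
  rw [pencilDet, pencilDet, RingHom.map_det]
  congr 1
  ext1 i j
  simp [Matrix.sum_apply]

theorem map_pencilCoeff {S' : Type*} [CommRing S'] (g : S →+* S')
    (A : Fin 4 → Matrix (Fin 4) (Fin 4) S) (d : QuarticMonomial) :
    g (pencilCoeff A d) = pencilCoeff (fun i => (A i).map g) d := by
  rw [pencilCoeff, pencilCoeff, ← map_pencilDet, coeff_map]

theorem isHomogeneous_pencilDet (A : Fin 4 → Matrix (Fin 4) (Fin 4) S) :
    (pencilDet A).IsHomogeneous 4 := by
  have hentry : ∀ p q, IsHomogeneous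
      ((∑ i, (X i : MvPolynomial (Fin 4) S) •
        (A i).map (C : S →+* MvPolynomial (Fin 4) S)) p q) 1 := by
    intro p q
    rw [Matrix.sum_apply]
    refine IsHomogeneous.sum _ _ _ fun i _ => ?_
    have := (isHomogeneous_X S i).mul (isHomogeneous_C (Fin 4) (A i p q))
    simpa using this
  rw [pencilDet, Matrix.det_apply]
  refine IsHomogeneous.sum _ _ _ fun σ _ => ?_
  have hprod := IsHomogeneous.prod Finset.univ _ (fun _ => 1) fun q _ => hentry (σ q) q
  simp only [Finset.sum_const, Finset.card_univ, Fintype.card_fin, smul_eq_mul, mul_one] at hprod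
  rcases Int.units_eq_one_or (Equiv.Perm.sign σ) with h | h
  · simpa [h] using hprod
  · simpa [h] using hprod.neg

theorem sum_monomial_pencilCoeff (A : Fin 4 → Matrix (Fin 4) (Fin 4) S) :
    ∑ d : QuarticMonomial, monomial d.1 (pencilCoeff A d) = pencilDet A := by
  ext e
  rw [coeff_sum]
  simp only [coeff_monomial]
  by_cases he : e ∈ (Finset.univ : Finset (Fin 4)).finsuppAntidiag 4
  · rw [Finset.sum_eq_single ⟨e, he⟩]
    · simp [pencilCoeff]
    · intro d _ hd
      exact if_neg fun h => hd (Subtype.ext h)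
    · simp
  · rw [Finset.sum_eq_zero]
    · by_contra hne
      have hdeg := isHomogeneous_pencilDet A (Ne.symm hne)
      refine he (Finset.mem_finsuppAntidiag.mpr ⟨?_, Finset.subset_univ _⟩)
      have hdeg' : e.degree = 4 := by
        rw [Finsupp.degree_eq_weight_one]
        exact hdeg
      refine Eq.trans ?_ hdeg'
      rw [Finsupp.degree_apply]
      exact (Finset.sum_subset (Finset.subset_univ _) (by simp)).symm
    · intro d _
      exact if_neg fun h : d.1 = e => he (h ▸ d.2)

theorem sum_prod_mul_pencilCoeff (A : Fin 4 → Matrix (Fin 4) (Fin 4) S) (x : Fin 4 → S) :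
    ∑ d : QuarticMonomial, (∏ i, x i ^ d.1 i) * pencilCoeff A d = (∑ i, x i • A i).det := by
  have h := congrArg (eval x) (sum_monomial_pencilCoeff A)
  rw [map_sum, pencilDet, RingHom.map_det] at h
  convert! h using 2
  · rename_i d _
    rw [eval_monomial, Finsupp.prod_fintype _ _ (fun _ => pow_zero _), mul_comm]
  · ext1 i j
    simp [Matrix.sum_apply]

theorem pencilCoeff_congruence (A : Fin 4 → Matrix (Fin 4) (Fin 4) S)
    (g : Matrix (Fin 4) (Fin 4) S) (d : QuarticMonomial) :
    pencilCoeff (fun i => g.transpose * A i * g) d = g.det ^ 2 * pencilCoeff A d := by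
  have h : pencilDet (fun i => g.transpose * A i * g) = C (g.det ^ 2) * pencilDet A := by
    let c : S →+* MvPolynomial (Fin 4) S := C
    have hmat : (∑ i, (X i : MvPolynomial (Fin 4) S) • (g.transpose * A i * g).map c) =
        (g.map c).transpose * (∑ i, (X i : MvPolynomial (Fin 4) S) • (A i).map c) * g.map c := by
      rw [Matrix.mul_sum, Matrix.sum_mul]
      refine Finset.sum_congr rfl fun i _ => ?_
      rw [Matrix.map_mul, Matrix.map_mul, Matrix.transpose_map, Matrix.mul_smul, Matrix.smul_mul]
    have hdet : (g.map c).det = C g.det := (RingHom.map_det c g).symm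
    rw [pencilDet, hmat, Matrix.det_mul, Matrix.det_mul, Matrix.det_transpose, hdet, pencilDet,
      map_pow]
    ring
  rw [pencilCoeff, h, coeff_C_mul, pencilCoeff]

end Pencil

theorem quarticForm_eq_determinantalForm_iff (A : Fin 4 → Matrix (Fin 4) (Fin 4) ℂ)
    (c : QuarticMonomial → ℂ) :
    quarticForm c = determinantalForm A ↔ c = pencilCoeff A := by
  constructor
  · intro h
    ext d
    rw [pencilCoeff, show pencilDet A = quarticForm c from h.symm, quarticForm, coeff_sum,
      Finset.sum_eq_single d]
    · simp
    · intro e _ he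
      exact (coeff_monomial _ _ _).trans (if_neg fun h => he (Subtype.ext h))
    · simp
  · rintro rfl
    exact sum_monomial_pencilCoeff A

/-! ### The normal form of a pencil of symmetric matrices -/

/-- The `24` parameters of a pencil in normal form: the entries of a diagonal matrix and those of
two symmetric matrices. -/
abbrev NormalFormParam : Type :=
  Fin 4 ⊕ Sym2 (Fin 4) ⊕ Sym2 (Fin 4)

section NormalForm

variable {S : Type*} [CommRing S]

/-- The pencil spanned by the identity, a diagonal matrix, and two symmetric matrices. -/
def normalForm (b : NormalFormParam → S) : Fin 4 → Matrix (Fin 4) (Fin 4) S :=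
  ![1, Matrix.diagonal fun i => b (Sum.inl i), Matrix.of fun i j => b (Sum.inr (Sum.inl s(i, j))),
    Matrix.of fun i j => b (Sum.inr (Sum.inr s(i, j)))]

theorem isSymm_normalForm (b : NormalFormParam → S) (i : Fin 4) : (normalForm b i).IsSymm := by
  fin_cases i
  · exact Matrix.isSymm_one
  · exact Matrix.isSymm_diagonal _
  · exact Matrix.IsSymm.ext fun i j => by simp [normalForm, Sym2.eq_swap]
  · exact Matrix.IsSymm.ext fun i j => by simp [normalForm, Sym2.eq_swap]

theorem map_normalForm {S' : Type*} [CommRing S'] (g : S →+* S') (b : NormalFormParam → S)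
    (i : Fin 4) : (normalForm b i).map g = normalForm (fun t => g (b t)) i := by
  fin_cases i
  · exact Matrix.map_one g (map_zero g) (map_one g)
  · exact Matrix.diagonal_map (map_zero g)
  · rfl
  · rfl

end NormalForm

/-- The coefficients of the determinant of the generic pencil in normal form. -/
noncomputable def normalFormCoeff (d : QuarticMonomial) : MvPolynomial NormalFormParam ℂ :=
  pencilCoeff (normalForm X) d

theorem eval_normalFormCoeff (b : NormalFormParam → ℂ) (d : QuarticMonomial) :
    eval b (normalFormCoeff d) = pencilCoeff (normalForm b) d := by
  rw [normalFormCoeff, map_pencilCoeff]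
  congr 1
  ext1 i
  rw [map_normalForm]
  simp

theorem paramLocus_normalFormCoeff_subset :
    ProjSpace.paramLocus normalFormCoeff ⊆ symmetroidLocus := by
  rintro p ⟨b, hb, hp⟩
  have hc : (fun d => eval b (normalFormCoeff d)) = pencilCoeff (normalForm b) := by
    ext d
    exact eval_normalFormCoeff b d
  exact ⟨normalForm b, fun d => eval b (normalFormCoeff d), hb, isSymm_normalForm b,
    (quarticForm_eq_determinantalForm_iff _ _).mpr hc, hp⟩

/-! ### Reduction of a generic pencil to the normal form -/

section MatrixDerivative

variable {k κ l m n : Type*} [Field k]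

/-- The product rule for the entrywise directional derivative at a point. -/
theorem Matrix.map_eval_dirDeriv_mul [Fintype m] (a v : κ → k)
    (M : Matrix l m (MvPolynomial κ k)) (N : Matrix m n (MvPolynomial κ k)) :
    (M * N).map (fun f => eval a (dirDeriv v f)) =
      M.map (eval a) * N.map (fun f => eval a (dirDeriv v f)) +
        M.map (fun f => eval a (dirDeriv v f)) * N.map (eval a) := by
  ext i j
  simp only [Matrix.map_apply, Matrix.mul_apply, Matrix.add_apply, map_sum, dirDeriv_mul, map_add,
    map_mul, Finset.sum_add_distrib]
  congr 1
  exact Finset.sum_congr rfl fun p _ => mul_comm _ _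

end MatrixDerivative

section Generic

variable {S : Type*} [CommRing S]

/-- The pencil of symmetric matrices with the given entries. -/
def symmetricPencil (e : Fin 4 × Sym2 (Fin 4) → S) (i : Fin 4) : Matrix (Fin 4) (Fin 4) S :=
  Matrix.of fun j l => e (i, s(j, l))

/-- The entries of the pencil obtained from a pencil in normal form, with parameters `b`, by the
congruence with the matrix `g`. -/
def congruenceEntry (g : Matrix (Fin 4) (Fin 4) S) (b : NormalFormParam → S)
    (q : Fin 4 × Sym2 (Fin 4)) : S :=
  q.2.lift ⟨fun j l => (g.transpose * normalForm b q.1 * g) j l, fun j l => by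
    have h : (g.transpose * normalForm b q.1 * g).IsSymm := by
      rw [Matrix.IsSymm, Matrix.transpose_mul, Matrix.transpose_mul, Matrix.transpose_transpose,
        isSymm_normalForm, Matrix.mul_assoc]
    exact h.apply l j⟩

theorem congruenceEntry_mk (g : Matrix (Fin 4) (Fin 4) S) (b : NormalFormParam → S)
    (i j l : Fin 4) :
    congruenceEntry g b (i, s(j, l)) = (g.transpose * normalForm b i * g) j l :=
  rfl

theorem symmetricPencil_congruenceEntry (g : Matrix (Fin 4) (Fin 4) S) (b : NormalFormParam → S) :
    symmetricPencil (congruenceEntry g b) = fun i => g.transpose * normalForm b i * g :=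
  rfl

theorem map_congruenceEntry {S' : Type*} [CommRing S'] (f : S →+* S')
    (g : Matrix (Fin 4) (Fin 4) S) (b : NormalFormParam → S) (q : Fin 4 × Sym2 (Fin 4)) :
    f (congruenceEntry g b q) = congruenceEntry (g.map f) (fun t => f (b t)) q := by
  obtain ⟨i, z⟩ := q
  induction z using Sym2.ind with
  | _ j l =>
    rw [congruenceEntry_mk, congruenceEntry_mk, ← map_normalForm, ← Matrix.transpose_map,
      ← Matrix.map_mul, ← Matrix.map_mul, Matrix.map_apply]

end Generic

/-- The entries of the generic pencil that is congruent to one in normal form, as polynomials in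
the entries of the transformation and the parameters of the normal form. -/
noncomputable def genericCongruenceEntry (q : Fin 4 × Sym2 (Fin 4)) :
    MvPolynomial ((Fin 4 × Fin 4) ⊕ NormalFormParam) ℂ :=
  congruenceEntry (Matrix.of fun j l => X (Sum.inl (j, l))) (fun t => X (Sum.inr t)) q

theorem eval_genericCongruenceEntry (c : (Fin 4 × Fin 4) ⊕ NormalFormParam → ℂ)
    (q : Fin 4 × Sym2 (Fin 4)) :
    eval c (genericCongruenceEntry q) =
      congruenceEntry (Matrix.of fun j l => c (Sum.inl (j, l))) (fun t => c (Sum.inr t)) q := by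
  rw [genericCongruenceEntry, map_congruenceEntry]
  congr 1
  · ext j l
    simp
  · ext t
    simp

/-- The generic pencil of symmetric matrices is congruent to one in normal form. At the identity
transformation and the diagonal matrix with entries `0, 1, 2, 3`, the differential of the congruence
is `(g, D, B, C) ↦ (gᵀ + g, gᵀ D₀ + D₀ g + D, B, C)`; it is invertible since `D₀` has distinct
eigenvalues. -/
theorem algebraicIndependent_genericCongruenceEntry :
    AlgebraicIndependent ℂ genericCongruenceEntry := by
  -- Any four distinct numbers would do.
  let d₀ : Fin 4 → ℂ := fun i => (i : ℕ)
  have hd₀ : ∀ {i j : Fin 4}, i ≠ j → d₀ i - d₀ j ≠ 0 := by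
    intro i j hij h
    exact hij (Fin.ext (Nat.cast_injective (R := ℂ) (sub_eq_zero.mp h)))
  let a : (Fin 4 × Fin 4) ⊕ NormalFormParam → ℂ :=
    Sum.elim (fun p => if p.1 = p.2 then 1 else 0) (Sum.elim d₀ 0)
  -- The solution of `gᵀ + g = w 0` and, away from the diagonal, `gᵀ D₀ + D₀ g = w 1`.
  let V : (Fin 4 × Sym2 (Fin 4) → ℂ) → Matrix (Fin 4) (Fin 4) ℂ := fun w => Matrix.of fun i j =>
    if i = j then w (0, s(i, i)) / 2 else
      (w (1, s(i, j)) - d₀ j * w (0, s(i, j))) / (d₀ i - d₀ j)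
  let v : (Fin 4 × Sym2 (Fin 4) → ℂ) → (Fin 4 × Fin 4) ⊕ NormalFormParam → ℂ := fun w =>
    Sum.elim (fun p => V w p.1 p.2) (Sum.elim (fun i => w (1, s(i, i)) - d₀ i * w (0, s(i, i)))
      (Sum.elim (fun z => w (2, z)) fun z => w (3, z)))
  have key : ∀ w q, eval a (dirDeriv (v w) (genericCongruenceEntry q)) = w q := by
    intro w q
    obtain ⟨i, z⟩ := q
    induction z using Sym2.ind with
    | _ j l =>
      let G : Matrix (Fin 4) (Fin 4) (MvPolynomial ((Fin 4 × Fin 4) ⊕ NormalFormParam) ℂ) :=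
        Matrix.of fun j l => X (Sum.inl (j, l))
      have hG : G.map (eval a) = 1 := by
        ext p q
        simp [G, a, Matrix.one_apply]
      have hGV : G.map (fun f => eval a (dirDeriv (v w) f)) = V w := by
        ext p q
        simp [G, v]
      let N := normalForm fun t =>
        (X (Sum.inr t) : MvPolynomial ((Fin 4 × Fin 4) ⊕ NormalFormParam) ℂ)
      have hN : ∀ i, (N i).map (eval a) = normalForm (Sum.elim d₀ 0) i := by
        intro i
        rw [map_normalForm]
        congr 1
        ext t
        simp [a]
      have hmul : eval a (dirDeriv (v w) (genericCongruenceEntry (i, s(j, l)))) =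
          (normalForm (Sum.elim d₀ 0) i * V w + ((N i).map (fun f => eval a (dirDeriv (v w) f)) +
            (V w).transpose * normalForm (Sum.elim d₀ 0) i)) j l := by
        change (G.transpose * N i * G).map (fun f => eval a (dirDeriv (v w) f)) j l = _
        rw [Matrix.map_eval_dirDeriv_mul, Matrix.map_eval_dirDeriv_mul, Matrix.map_mul,
          Matrix.transpose_map, Matrix.transpose_map, hG, hGV, hN, Matrix.transpose_one,
          Matrix.one_mul, Matrix.one_mul, Matrix.mul_one]
      rw [hmul]
      have hV : ∀ {j l}, j ≠ l → V w j l + V w l j = w (0, s(j, l)) ∧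
          d₀ j * V w j l + V w l j * d₀ l = w (1, s(j, l)) := by
        intro j l hjl
        have h1 := hd₀ hjl
        have h2 := hd₀ hjl.symm
        simp only [V, Matrix.of_apply, if_neg hjl, if_neg hjl.symm, Sym2.eq_swap (a := l) (b := j)]
        constructor
        · field_simp
          ring
        · field_simp
          ring
      have hVd : ∀ j, V w j j = w (0, s(j, j)) / 2 := fun j => by simp [V]
      by_cases hjl : j = l
      · subst hjl
        fin_cases i
        · simp [normalForm, N, hVd]
        · simp [normalForm, N, hVd, v]
          ring
        · simp [normalForm, N, v, Matrix.mul_apply]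
        · simp [normalForm, N, v, Matrix.mul_apply]
      · have h1 := hV hjl
        fin_cases i
        · simp [normalForm, N, hjl, h1.1]
        · simp [normalForm, N, hjl, h1.2]
        · simp [normalForm, N, v, Matrix.mul_apply]
        · simp [normalForm, N, v, Matrix.mul_apply]
  exact algebraicIndependent_of_jacobian _ a (fun q => v (Pi.single q 1)) fun q q' => by
    rw [key, Pi.single_apply]
    simp only [eq_comm]

/-- A form that vanishes on the symmetroids in normal form vanishes on all symmetroids: as the
generic pencil is congruent to one in normal form, it vanishes on the generic symmetroid. -/
theorem eval_pencilCoeff_eq_zero {f : MvPolynomial QuarticMonomial ℂ} {n : ℕ}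
    (hf : f.IsHomogeneous n) (h : aeval normalFormCoeff f = 0)
    {A : Fin 4 → Matrix (Fin 4) (Fin 4) ℂ} (hA : ∀ i, (A i).IsSymm) :
    eval (pencilCoeff A) f = 0 := by
  let H : QuarticMonomial → MvPolynomial (Fin 4 × Sym2 (Fin 4)) ℂ :=
    pencilCoeff (symmetricPencil X)
  have hH : ∀ e d, eval e (H d) = pencilCoeff (symmetricPencil e) d := by
    intro e d
    rw [map_pencilCoeff]
    congr 1
    ext i j l
    simp [symmetricPencil]
  have hgen : aeval H f = 0 := by
    refine (algebraicIndependent_iff.mp algebraicIndependent_genericCongruenceEntry) _ ?_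
    refine MvPolynomial.funext fun c => ?_
    rw [eval_aeval, eval_aeval, map_zero]
    simp only [hH]
    have hcong : pencilCoeff (symmetricPencil fun q => eval c (genericCongruenceEntry q)) =
        fun d => (Matrix.of fun j l => c (Sum.inl (j, l))).det ^ 2 *
          eval (fun t => c (Sum.inr t)) (normalFormCoeff d) := by
      ext d
      rw [funext (eval_genericCongruenceEntry c), symmetricPencil_congruenceEntry,
        pencilCoeff_congruence, eval_normalFormCoeff]
    have h1 := aeval_mul_of_isHomogeneous hf ((Matrix.of fun j l => c (Sum.inl (j, l))).det ^ 2)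
      fun d => eval (fun t => c (Sum.inr t)) (normalFormCoeff d)
    have h2 : eval (fun d => eval (fun t => c (Sum.inr t)) (normalFormCoeff d)) f = 0 := by
      rw [← eval_aeval, h, map_zero]
    rw [hcong]
    refine Eq.trans h1 ?_
    exact (congrArg _ h2).trans (mul_zero _)
  let e : Fin 4 × Sym2 (Fin 4) → ℂ := fun q =>
    q.2.lift ⟨fun j l => A q.1 j l, fun j l => (hA q.1).apply l j⟩
  have he : symmetricPencil e = A := rfl
  have h1 := congrArg (eval e) hgen
  rw [eval_aeval, map_zero, funext (hH e), he] at h1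
  exact h1

theorem symmetroidLocus_subset_closure (h0 : normalFormCoeff ≠ 0) :
    symmetroidLocus ⊆ closure (ProjSpace.paramLocus normalFormCoeff) := by
  rintro _ ⟨A, c, hc, hA, hcA, rfl⟩
  rw [quarticForm_eq_determinantalForm_iff] at hcA
  subst hcA
  obtain ⟨S, hS, hcl⟩ := (ProjSpace.isClosed_iff _).mp
    (isClosed_closure (s := ProjSpace.paramLocus normalFormCoeff))
  rw [hcl, ProjSpace.mk_mem_zeroLocus hS]
  intro f hf
  obtain ⟨n, hn⟩ := hS f hf
  refine eval_pencilCoeff_eq_zero hn ?_ hA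
  rw [← ProjSpace.mem_vanishingIdeal_closure_paramLocus h0 hn]
  exact (ProjSpace.subset_zeroLocus_iff hS).mp hcl.subset hf

theorem quarticSymmetroids_eq_closure_paramLocus (h0 : normalFormCoeff ≠ 0) :
    quarticSymmetroids = closure (ProjSpace.paramLocus normalFormCoeff) :=
  (closure_minimal (symmetroidLocus_subset_closure h0) isClosed_closure).antisymm
    (closure_mono paramLocus_normalFormCoeff_subset)

/-! ### The differential of the normal form -/

theorem card_normalFormParam : Fintype.card NormalFormParam = 24 := by
  simp [Sym2.card, Nat.choose]

/-- A symmetric `4 × 4` determinant, written out. -/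
theorem det_symm_fin_four {S : Type*} [CommRing S] (m00 m01 m02 m03 m11 m12 m13 m22 m23 m33 : S) :
    !![m00, m01, m02, m03; m01, m11, m12, m13; m02, m12, m22, m23; m03, m13, m23, m33].det =
      m00 * m11 * (m22 * m33 - m23 * m23) - m00 * m12 * (m12 * m33 - m13 * m23) +
      m00 * m13 * (m12 * m23 - m13 * m22) - m01 * m01 * (m22 * m33 - m23 * m23) +
      2 * m01 * m02 * (m12 * m33 - m13 * m23) - 2 * m01 * m03 * (m12 * m23 - m13 * m22) +
      m02 * m02 * (m13 * m13 - m11 * m33) + 2 * m02 * m03 * (m11 * m23 - m12 * m13) +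
      m03 * m03 * (m12 * m12 - m11 * m22) := by
  simp [Matrix.det_succ_row_zero, Fin.sum_univ_succ, Fin.succAbove]
  ring

/-- The diagonal entries `0, 1, -1, 2`, together with the matrices of the quadratic forms
`2 (x₁ x₂ + x₁ x₃)` and `2 x₀ x₂`. -/
def basePoint : NormalFormParam → ℂ :=
  Sum.elim ![0, 1, -1, 2] (Sum.elim (fun z => if z = s(1, 2) ∨ z = s(1, 3) then 1 else 0)
    (fun z => if z = s(0, 2) then 1 else 0))

/-- The equation that the kernel of the differential at the base point satisfies for each point `x`
at which the quartic form is evaluated: it is the derivative of a determinant. -/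
theorem coneDifferential_normalFormCoeff_eval {w : Option NormalFormParam → ℂ}
    (hw : ProjSpace.coneDifferential normalFormCoeff basePoint w = 0) {d : Fin 4 → ℂ}
    {b c : Fin 4 → Fin 4 → ℂ} (hd : ∀ i, w (some (Sum.inl i)) = d i)
    (hb : ∀ i j, w (some (Sum.inr (Sum.inl s(i, j)))) = b i j)
    (hc : ∀ i j, w (some (Sum.inr (Sum.inr s(i, j)))) = c i j) (x₀ x₁ x₂ x₃ : ℂ) :
    w none * (x₀ * (x₀ + x₁) * (x₀ - x₁) * (x₀ + 2 * x₁) - x₀ * x₂ ^ 2 * (x₀ + 2 * x₁) -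
        x₀ * x₂ ^ 2 * (x₀ - x₁) + x₂ ^ 2 * x₃ ^ 2 - x₃ ^ 2 * (x₀ + x₁) * (x₀ + 2 * x₁)) +
      ((x₀ + x₁) * (x₀ - x₁) * (x₀ + 2 * x₁) - x₂ ^ 2 * (x₀ + 2 * x₁) - x₂ ^ 2 * (x₀ - x₁)) *
        (x₂ * b 0 0 + x₃ * c 0 0) +
      (x₀ * (x₀ - x₁) * (x₀ + 2 * x₁) - x₃ ^ 2 * (x₀ + 2 * x₁)) *
        (x₁ * d 1 + x₂ * b 1 1 + x₃ * c 1 1) +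
      (x₀ * (x₀ + x₁) * (x₀ + 2 * x₁) - x₀ * x₂ ^ 2) * (x₁ * d 2 + x₂ * b 2 2 + x₃ * c 2 2) +
      (x₀ * (x₀ + x₁) * (x₀ - x₁) - x₀ * x₂ ^ 2 - x₃ ^ 2 * (x₀ + x₁)) *
        (x₁ * d 3 + x₂ * b 3 3 + x₃ * c 3 3) +
      ((x₀ + x₁) * (x₀ - x₁) * (x₀ + 2 * x₁) - x₂ ^ 2 * (x₀ + 2 * x₁) - x₂ ^ 2 * (x₀ - x₁)) *
        (x₁ * d 0) +
      2 * x₂ * x₃ * (x₀ + 2 * x₁) * (x₂ * b 0 1 + x₃ * c 0 1) +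
      2 * x₃ * (x₂ ^ 2 - (x₀ + x₁) * (x₀ + 2 * x₁)) * (x₂ * b 0 2 + x₃ * c 0 2) -
      2 * x₂ ^ 2 * x₃ * (x₂ * b 0 3 + x₃ * c 0 3) -
      2 * x₀ * x₂ * (x₀ + 2 * x₁) * (x₂ * b 1 2 + x₃ * c 1 2) +
      2 * x₂ * (x₃ ^ 2 - x₀ * (x₀ - x₁)) * (x₂ * b 1 3 + x₃ * c 1 3) +
      2 * x₀ * x₂ ^ 2 * (x₂ * b 2 3 + x₃ * c 2 3) = 0 := by
  let x : Fin 4 → ℂ := ![x₀, x₁, x₂, x₃]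
  -- The value of the generic quartic form in normal form at the point `x`.
  let P : MvPolynomial NormalFormParam ℂ :=
    ∑ d : QuarticMonomial, (∏ i, C (x i) ^ d.1 i) * normalFormCoeff d
  have h1 : w none * eval basePoint P + eval basePoint (dirDeriv (fun t => w (some t)) P) = 0 := by
    have hC : ∀ d : QuarticMonomial, ∏ i, (C (x i) : MvPolynomial NormalFormParam ℂ) ^ d.1 i =
        C (∏ i, x i ^ d.1 i) := by
      intro d
      simp only [map_prod, map_pow]
    simp only [P, hC, map_sum, map_mul, dirDeriv_mul, derivation_C, mul_zero, add_zero, eval_C]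
    rw [Finset.mul_sum, ← Finset.sum_add_distrib]
    refine Finset.sum_eq_zero fun d _ => ?_
    have := congrFun hw d
    simp only [ProjSpace.coneDifferential, LinearMap.coe_mk, AddHom.coe_mk, Pi.zero_apply] at this
    linear_combination (∏ i, x i ^ d.1 i) * this
  -- The entries of the symmetric matrix whose determinant is `P`.
  let m : Fin 4 → Fin 4 → MvPolynomial NormalFormParam ℂ := fun i j =>
    (if i = j then C x₀ + C x₁ * X (Sum.inl i) else 0) + C x₂ * X (Sum.inr (Sum.inl s(i, j))) +
      C x₃ * X (Sum.inr (Sum.inr s(i, j)))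
  have hP : P = !![m 0 0, m 0 1, m 0 2, m 0 3; m 0 1, m 1 1, m 1 2, m 1 3;
      m 0 2, m 1 2, m 2 2, m 2 3; m 0 3, m 1 3, m 2 3, m 3 3].det := by
    have hsum := sum_prod_mul_pencilCoeff (normalForm (X (R := ℂ))) fun i => C (x i)
    refine Eq.trans hsum (congrArg Matrix.det ?_)
    have hm : ∀ i j, m i j = m j i := by
      intro i j
      simp only [m, Sym2.eq_swap (a := j) (b := i), eq_comm (a := j)]
      split_ifs with hij
      · rw [hij]
      · rfl
    have hent : ∀ i j, (∑ p, (C (x p) : MvPolynomial NormalFormParam ℂ) •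
        normalForm (X (R := ℂ)) p) i j = m i j := by
      intro i j
      by_cases hij : i = j
      · subst hij
        simp [Matrix.sum_apply, Fin.sum_univ_four, normalForm, m, x, smul_eq_mul]
      · simp [Matrix.sum_apply, Fin.sum_univ_four, normalForm, m, x, hij]
    ext1 i j
    rw [hent]
    fin_cases i <;> fin_cases j <;> first | rfl | exact hm _ _
  have he : ∀ i j, eval basePoint (m i j) = (if i = j then x₀ + x₁ * basePoint (Sum.inl i) else 0) +
      x₂ * basePoint (Sum.inr (Sum.inl s(i, j))) + x₃ * basePoint (Sum.inr (Sum.inr s(i, j))) := by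
    intro i j
    by_cases hij : i = j <;> simp [m, hij]
  have hn : ∀ i j, eval basePoint (dirDeriv (fun t => w (some t)) (m i j)) =
      (if i = j then x₁ * d i else 0) + x₂ * b i j + x₃ * c i j := by
    intro i j
    by_cases hij : i = j <;> simp [m, hij, hd, hb, hc]
  rw [hP, det_symm_fin_four] at h1
  -- From here on only the values and the derivatives of the entries at the base point matter.
  generalize m = m' at *
  have htwo : (2 : MvPolynomial NormalFormParam ℂ) = C 2 := rfl
  simp only [map_add, map_sub, map_mul, dirDeriv_mul, he, hn, htwo, eval_C, derivation_C] at h1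
  simp [basePoint] at h1
  linear_combination h1

/-- Evaluating the quartic form at points with small coordinates gives one coordinate of a vector in
the kernel after the other. -/
theorem coneDifferential_normalFormCoeff_injective :
    Function.Injective (ProjSpace.coneDifferential normalFormCoeff basePoint) := by
  rw [← LinearMap.ker_eq_bot, LinearMap.ker_eq_bot']
  intro w hw
  obtain ⟨d, hd⟩ : ∃ d : Fin 4 → ℂ, ∀ i, w (some (Sum.inl i)) = d i := ⟨_, fun _ => rfl⟩
  obtain ⟨b, hb⟩ : ∃ b : Fin 4 → Fin 4 → ℂ, ∀ i j, w (some (Sum.inr (Sum.inl s(i, j)))) = b i j :=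
    ⟨_, fun _ _ => rfl⟩
  obtain ⟨c, hc⟩ : ∃ c : Fin 4 → Fin 4 → ℂ, ∀ i j, w (some (Sum.inr (Sum.inr s(i, j)))) = c i j :=
    ⟨_, fun _ _ => rfl⟩
  have E := coneDifferential_normalFormCoeff_eval hw hd hb hc
  have hs : w none = 0 := by linear_combination E 1 0 0 0
  have hd0 : d 0 = 0 := by linear_combination -1/2 * E 0 1 0 0
  have hb00 : b 0 0 = 0 := by linear_combination 1/3 * E 0 1 (-1) 0 + hd0
  have hd1 : d 1 = 0 := by linear_combination 1/2 * E 1 (-1) 0 0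
  have hc11 : c 1 1 = 0 := by linear_combination E 1 (-1) 0 (-1) - hd1
  have hd2 : d 2 = 0 := by linear_combination 1/6 * E 1 1 0 0
  have hd3 : d 3 = 0 := by linear_combination -1/6 * E 2 (-1) 0 0
  have hc33 : c 3 3 = 0 := by linear_combination -1/5 * E 2 (-1) 0 (-1) - hd3
  have hc02 : c 0 2 = 0 := by
    linear_combination 1/4 * E 0 1 0 (-1) - 1/8 * E 0 1 0 (-2) - 1/2 * hs + 1/4 * hd0 - 1/2 * hd1
      - 1/4 * hd3 + 3/2 * hc11 + 3/4 * hc33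
  have hc00 : c 0 0 = 0 := by
    linear_combination 1/2 * E 0 1 0 (-1) + hs + hd0 + hd1 + 1/2 * hd3 + 2 * hc02 - hc11
      - 1/2 * hc33
  have hc22 : c 2 2 = 0 := by linear_combination -E 1 0 0 (-1) - hc00 - 2 * hc02
  have hb12 : b 1 2 = 0 := by
    linear_combination -1/12 * E 1 1 1 0 - 1/12 * E 1 1 (-1) 0 - 1/2 * hs - 1/2 * hd0 + 5/6 * hd2
      - 1/6 * hd3
  have hb13 : b 1 3 = 0 := by
    linear_combination -1/4 * E 1 0 1 0 - 1/4 * E 1 0 (-1) 0 - 1/2 * hs - hb12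
  have hb22 : b 2 2 = 0 := by
    linear_combination -2/9 * E 1 1 (-1) 0 + 1/36 * E 1 1 (-2) 0 - 1/3 * hs - 1/3 * hd0
      + 19/18 * hd2 - 1/9 * hd3 - 2/3 * hb12
  have hb33 : b 3 3 = 0 := by
    linear_combination -1/12 * E 2 (-1) (-2) 0 + 4/3 * E 1 1 (-1) 0 + 2 * hs + 5 * hd0 - 6 * hd2
      + 3/2 * hd3 - 2 * hb00 + 8 * hb12 - 4 * hb13 + 8 * hb22
  have hb23 : b 2 3 = 0 := by
    linear_combination -1/2 * E 1 1 (-1) 0 - 3/2 * hs - 3/2 * hd0 + 5/2 * hd2 - 1/2 * hd3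
      + 3/2 * hb00 - 3 * hb12 - 5/2 * hb22 + 1/2 * hb33
  have hb11 : b 1 1 = 0 := by
    linear_combination -E 1 0 (-1) 0 - hs + hb00 - 2 * hb12 - 2 * hb13 - 2 * hb23
  have hc03 : c 0 3 = 0 := by
    linear_combination -1/4 * E 0 0 1 1 - 1/4 * E 0 0 1 (-1) + 1/2 * hs + hb13 + hc02
  have hc13 : c 1 3 = 0 := by
    linear_combination 1/6 * E 0 0 1 (-1) - 1/12 * E 0 0 1 (-2) + 1/6 * hs + 1/3 * hb13
      + 1/3 * hc02 - 1/3 * hc03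
  have hc23 : c 2 3 = 0 := by
    linear_combination -1/16 * E 2 (-1) (-2) (-1) - 1/2 * E 0 0 1 (-1) - 3/4 * hs + 3/4 * hd0
      + 1/2 * hd2 + 3/16 * hd3 + 3/2 * hb00 - 3/2 * hb13 + hb22 - 2 * hb23 + 3/8 * hb33
      + 3/4 * hc00 + 3/2 * hc02 - 3/2 * hc03 - 9/4 * hc13 + 1/2 * hc22 + 3/16 * hc33
  have hc01 : c 0 1 = 0 := by
    linear_combination 1/8 * E 0 1 (-2) (-1) - 1/16 * E 0 1 (-2) (-2) + 1/4 * hs + 3/8 * hd0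
      - 1/4 * hd1 - 1/8 * hd3 - 3/4 * hb00 + 1/2 * hb11 + hb13 + 1/4 * hb33 + 1/2 * hc02 - hc03
      + 3/4 * hc11 + 3/2 * hc13 + 3/8 * hc33
  have hb03 : b 0 3 = 0 := by
    linear_combination 1/6 * E 0 1 1 (-1) - 1/24 * E 0 1 (-2) (-1) + 1/4 * hs + 1/4 * hd0
      + 1/4 * hd1 + 1/8 * hd3 + hb00 + 1/2 * hb11 + 1/4 * hb33 - 1/4 * hc00 - hc01 + 1/2 * hc02
      - 1/4 * hc11 + 1/2 * hc13 - 1/8 * hc33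
  have hb02 : b 0 2 = 0 := by
    linear_combination -1/2 * E 0 0 1 (-1) + 1/2 * hs + hb03 + hb13 + hc02 - hc03 - hc13
  have hb01 : b 0 1 = 0 := by
    linear_combination -1/4 * E 0 1 (-1) (-1) - 1/4 * hs - 3/4 * hd0 - 1/2 * hd1 - 1/4 * hd3
      + 3/4 * hb00 - 1/2 * hb02 - 1/2 * hb03 + 1/2 * hb11 + 1/2 * hb13 + 1/4 * hb33 + 3/4 * hc00
      - hc01 - 1/2 * hc02 - 1/2 * hc03 + 1/2 * hc11 + 1/2 * hc13 + 1/4 * hc33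
  have hc12 : c 1 2 = 0 := by
    linear_combination -1/2 * E 1 0 (-1) (-1) - 1/2 * hs + 1/2 * hb00 - hb01 - hb03 - hb12 - hb23
      + 1/2 * hb33 + 1/2 * hc00 - hc01 - hc03 - hc23 + 1/2 * hc33
  have hbsymm : ∀ i j, b i j = b j i := fun i j => by rw [← hb, ← hb, Sym2.eq_swap]
  have hcsymm : ∀ i j, c i j = c j i := fun i j => by rw [← hc, ← hc, Sym2.eq_swap]
  ext o
  rcases o with _ | i | z | z
  · exact hs
  · rw [hd]
    fin_cases i <;> assumption
  · induction z using Sym2.ind with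
    | _ i j =>
      rw [hb]
      fin_cases i <;> fin_cases j <;> first | assumption | (rw [hbsymm]; assumption)
  · induction z using Sym2.ind with
    | _ i j =>
      rw [hc]
      fin_cases i <;> fin_cases j <;> first | assumption | (rw [hcsymm]; assumption)

/-! ### The variety of quartic symmetroids -/

theorem normalFormCoeff_ne_zero : normalFormCoeff ≠ 0 := by
  have h := ProjSpace.freeze_ne_zero coneDifferential_normalFormCoeff_injective ∅
  intro h0
  exact h (funext fun d => by rw [h0, Pi.zero_apply, map_zero])

/-- The variety of quartic symmetroids is irreducible, has dimension `24`, and has codimension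
`10` in `ℙ³⁴` (the supremum of the lengths of chains of irreducible closed subsets that start
at it). -/
theorem mainTheorem7 :
    ∃ h : IsIrreducible quarticSymmetroids,
      topologicalKrullDim quarticSymmetroids = 24 ∧
      Order.coheight (⟨quarticSymmetroids, h, isClosed_closure⟩ :
        TopologicalSpace.IrreducibleCloseds QuarticSurfaces) = 10 := by
  have hcl := quarticSymmetroids_eq_closure_paramLocus normalFormCoeff_ne_zero
  have h : IsIrreducible quarticSymmetroids :=
    hcl ▸ (ProjSpace.isIrreducible_paramLocus normalFormCoeff_ne_zero).closure
  let Z : TopologicalSpace.IrreducibleCloseds QuarticSurfaces :=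
    ⟨quarticSymmetroids, h, isClosed_closure⟩
  have hZ : Z = ProjSpace.paramVariety normalFormCoeff normalFormCoeff_ne_zero :=
    TopologicalSpace.IrreducibleCloseds.ext hcl
  have hdim := ProjSpace.height_and_coheight_paramVariety normalFormCoeff_ne_zero
    coneDifferential_normalFormCoeff_injective (m := 10)
    (by rw [card_normalFormParam, card_quarticMonomial])
  rw [← hZ, card_normalFormParam] at hdim
  refine ⟨h, ?_, hdim.2⟩
  exact Z.topologicalKrullDim_eq_height.trans (congrArg _ hdim.1)
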